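/- Let $N\ge 2$, write $x=(x',x_N)$ for points of $\mathbb R^N=\mathbb R^{N-1}\times\mathbb R$, let $\mathbb R^N_+=\{x_N>0\}$, and identify $\partial\mathbb R^N_+$ with $\mathbb R^{N-1}$. A local Radon measure on a $\sigma$-compact locally compact Hausdorff space $X$ is a continuous linear functional on $C_c(X)$; it is written $\mu=\mu^+-\mu^-$ (Jordan decomposition into positive Radon measures), and $|\mu|=\mu^++\mu^-$. Let $\mu$ be a local Radon measure on $\mathbb R^N_+$ with $\int_\Omega x_N\,d|\mu|<\infty$ for every bounded $\Omega\subset\mathbb R^N_+$. Let $u$ be a function on $\mathbb R^N_+$ that is integrable on every bounded open subset of $\mathbb R^N_+$ and satisfies $\Delta u=\mu$ in $\mathcal D'(\mathbb R^N_+)$. Suppose that a local Radon measure $\nu$ on $\mathbb R^{N-1}$ is the lim-trace of $u$, that is, $u\in W^{1,p}_{loc}(\mathbb R^N_+)$ for some $1<p<\infty$ and $$\lim_{\epsilon\to0^+}\int_{\mathbb R^{N-1}}\psi(x')\,u(x',\epsilon)\,dx'=\int_{\mathbb R^{N-1}}\psi\,d\nu\qquad\text{for every }\psi\in C^2_c(\mathbb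 R^{N-1}),$$ where $u(\cdot,\epsilon)$ is the Sobolev trace of $u$ on the hyperplane $\{x_N=\epsilon\}$. Then $u$ is a weak solution of $\Delta u=\mu$ in $\mathbb R^N_+$, $u=\nu$ on $\partial\mathbb R^N_+$, that is, for every $\varphi\in C^2_c(\mathbb R^N)$ with $\varphi(x',0)=0$ for all $x'\in\mathbb R^{N-1}$, $$-\int_{\mathbb R^N_+}\varphi\,d\mu+\int_{\mathbb R^{N-1}}\partial_N\varphi(x',0)\,d\nu(x')=\int_{\mathbb R^N_+}u\,(-\Delta\varphi)\,dx .$$ -/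

import Mathlib

open MeasureTheory Filter Topology
open scoped ContDiff

/-- `ℝ^{N-1}`, identified with the boundary `ℝ^{N-1} × {0}` of the half-space. -/
abbrev Bdry (N : ℕ) : Type := EuclideanSpace ℝ (Fin (N - 1))

/-- `ℝ^N = ℝ^{N-1} × ℝ`, with points `x = (x', x_N)`, so that `x.1 = x'` and `x.2 = x_N`.
Its volume is Lebesgue measure. -/
abbrev Space (N : ℕ) : Type := Bdry N × ℝ

/-- The open half-space `{x_N > 0}`. -/
def halfSpace (N : ℕ) : Set (Space N) := {x | 0 < x.2}

/-- The standard basis of `ℝ^N`: `none` indexes the direction of `x_N`. -/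
noncomputable def stdVec (N : ℕ) : Option (Fin (N - 1)) → Space N
  | none => (0, 1)
  | some i => (EuclideanSpace.single i 1, 0)

/-- The classical partial derivative `∂_j φ` of a differentiable function. -/
noncomputable def partialD {N : ℕ} (j : Option (Fin (N - 1))) (φ : Space N → ℝ) :
    Space N → ℝ :=
  fun x => fderiv ℝ φ x (stdVec N j)

/-- The Laplacian `Δ φ = ∑_j ∂_j ∂_j φ` of a `C²` function. -/
noncomputable def laplace {N : ℕ} (φ : Space N → ℝ) : Space N → ℝ :=
  fun x => ∑ j, partialD j (partialD j φ) x

/-- A local Radon measure `μ = μ⁺ - μ⁻` on a (locally compact, σ-compact, metrizable) space,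
given by its Jordan decomposition: `μ⁺`, `μ⁻` are mutually singular positive Radon measures, both
possibly of infinite total mass. By the Riesz representation theorem these are exactly the
continuous linear functionals `φ ↦ ∫ φ dμ⁺ - ∫ φ dμ⁻` on `C_c(X)`. -/
structure LocalRadonMeasure (X : Type*) [TopologicalSpace X] [MeasurableSpace X] where
  posPart : Measure X
  negPart : Measure X
  posPart_regular : posPart.Regular
  negPart_regular : negPart.Regular
  mutuallySingular : posPart.MutuallySingular negPart

namespace LocalRadonMeasure

variable {X : Type*} [TopologicalSpace X] [MeasurableSpace X]

/-- `|μ| = μ⁺ + μ⁻`. -/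
noncomputable def abs (μ : LocalRadonMeasure X) : Measure X := μ.posPart + μ.negPart

/-- `∫ f dμ = ∫ f dμ⁺ - ∫ f dμ⁻`, for `f` integrable with respect to `|μ|`. -/
noncomputable def integral (μ : LocalRadonMeasure X) (f : X → ℝ) : ℝ :=
  ∫ x, f x ∂μ.posPart - ∫ x, f x ∂μ.negPart

end LocalRadonMeasure

/-- `μ ∈ M_loc(closure of the half-space, x_N)`: the local Radon measure `μ` on the open
half-space satisfies `∫_Ω x_N d|μ| < ∞` for every bounded subset `Ω` of the half-space. -/
def IsWeighted {N : ℕ} (μ : LocalRadonMeasure (halfSpace N)) : Prop :=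
  ∀ Ω : Set (halfSpace N), Bornology.IsBounded Ω →
    ∫⁻ x in Ω, ENNReal.ofReal (x : Space N).2 ∂μ.abs < ⊤

/-- `u ∈ L¹_loc(closure of the half-space)`: `u` is integrable on every bounded open subset of the
half-space. Only the values of `u` on the half-space matter, here and below. -/
def IsL1LocClosure {N : ℕ} (u : Space N → ℝ) : Prop :=
  ∀ Ω : Set (Space N), IsOpen Ω → Bornology.IsBounded Ω → Ω ⊆ halfSpace N →
    IntegrableOn u Ω

/-- `φ ∈ C_c^∞(half-space)`. -/
structure IsTestFunction {N : ℕ} (φ : Space N → ℝ) : Prop where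
  smooth : ContDiff ℝ ∞ φ
  compactSupport : HasCompactSupport φ
  tsupport_subset : tsupport φ ⊆ halfSpace N

/-- `Δ u = μ` in the sense of distributions on the half-space. -/
def IsDistribSolution {N : ℕ} (u : Space N → ℝ) (μ : LocalRadonMeasure (halfSpace N)) : Prop :=
  ∀ φ : Space N → ℝ, IsTestFunction φ →
    ∫ x in halfSpace N, u x * laplace φ x = μ.integral (fun x => φ x)

/-- `w` is the weak (distributional) partial derivative `∂_j u` on the half-space. -/
structure IsWeakPartial {N : ℕ} (j : Option (Fin (N - 1))) (u w : Space N → ℝ) : Prop where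
  locallyIntegrable : LocallyIntegrableOn u (halfSpace N)
  locallyIntegrable_deriv : LocallyIntegrableOn w (halfSpace N)
  eq : ∀ φ : Space N → ℝ, IsTestFunction φ →
    ∫ x in halfSpace N, u x * partialD j φ x = -∫ x in halfSpace N, w x * φ x

/-- `u ∈ L^p_loc(A)`: `u` is in `L^p(K)` for every compact `K ⊆ A`. -/
def MemLpLoc {X : Type*} [TopologicalSpace X] [MeasureSpace X] (p : ENNReal) (A : Set X)
    (u : X → ℝ) : Prop :=
  ∀ K : Set X, IsCompact K → K ⊆ A → MemLp u p (volume.restrict K)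

/-- `v k → u` in `L^p_loc(A)`. -/
def TendstoLpLoc {X : Type*} [TopologicalSpace X] [MeasureSpace X] (p : ENNReal) (A : Set X)
    (v : ℕ → X → ℝ) (u : X → ℝ) : Prop :=
  ∀ K : Set X, IsCompact K → K ⊆ A →
    Tendsto (fun k => eLpNorm (fun x => v k x - u x) p (volume.restrict K)) atTop (𝓝 0)

/-- `u ∈ W^{1,p}_loc(half-space)`. -/
def MemW1pLoc {N : ℕ} (p : ENNReal) (u : Space N → ℝ) : Prop :=
  MemLpLoc p (halfSpace N) u ∧
    ∀ j, ∃ w : Space N → ℝ, IsWeakPartial j u w ∧ MemLpLoc p (halfSpace N) w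

/-- `g` is the Sobolev trace of `u ∈ W^{1,p}_loc(half-space)` on the hyperplane `x_N = ε`: the trace
operator is the continuous extension of the restriction of smooth functions, that is, `g` is the
limit in `L^p_loc(ℝ^{N-1})` of `v k (·, ε)` for smooth `v k` with `v k → u` in
`W^{1,p}_loc(half-space)`. -/
def IsSobolevTrace {N : ℕ} (p : ENNReal) (u : Space N → ℝ) (ε : ℝ) (g : Bdry N → ℝ) : Prop :=
  MemLpLoc p Set.univ g ∧
    ∃ v : ℕ → Space N → ℝ,
      (∀ k, ContDiff ℝ ∞ (v k)) ∧
      TendstoLpLoc p (halfSpace N) v u ∧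
      (∀ j, ∃ w : Space N → ℝ, IsWeakPartial j u w ∧
        TendstoLpLoc p (halfSpace N) (fun k => partialD j (v k)) w) ∧
      TendstoLpLoc p Set.univ (fun k x' => v k (x', ε)) g

/-- `ν` is the lim-trace of `u` on the boundary: `u ∈ W^{1,p}_loc(half-space)` for some
`1 < p < ∞`, and the Sobolev traces `u(·, ε)` of `u` on the hyperplanes `x_N = ε` satisfy
`∫ ψ(x') u(x', ε) dx' → ∫ ψ dν` as `ε → 0⁺` for all `ψ ∈ C²_c(ℝ^{N-1})`. -/
def HasLimTrace {N : ℕ} (u : Space N → ℝ) (ν : LocalRadonMeasure (Bdry N)) : Prop :=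
  ∃ p : ENNReal, 1 < p ∧ p ≠ ⊤ ∧ MemW1pLoc p u ∧
    ∃ tr : ℝ → Bdry N → ℝ, (∀ ε, 0 < ε → IsSobolevTrace p u ε (tr ε)) ∧
      ∀ ψ : Bdry N → ℝ, ContDiff ℝ 2 ψ → HasCompactSupport ψ →
        Tendsto (fun ε => ∫ x', ψ x' * tr ε x') (𝓝[>] 0) (𝓝 (ν.integral ψ))

/-- `φ ∈ D₀`: `φ ∈ C²_c(ℝ^N)` (so its support may meet the boundary) and `φ(x', 0) = 0`. -/
structure IsD0 {N : ℕ} (φ : Space N → ℝ) : Prop where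
  contDiff : ContDiff ℝ 2 φ
  compactSupport : HasCompactSupport φ
  boundary : ∀ x' : Bdry N, φ (x', 0) = 0

/-- `u` is a weak solution of `Δ u = μ` on the half-space, `u = ν` on its boundary, that is, of
`-Δ u = -μ`, `u = ν`. The integral of `φ` against `μ` converges because `|φ| ≤ C x_N` on the
half-space and `μ` is weighted. -/
structure IsWeakSolution {N : ℕ} (u : Space N → ℝ) (μ : LocalRadonMeasure (halfSpace N))
    (ν : LocalRadonMeasure (Bdry N)) : Prop where
  weighted : IsWeighted μ
  locallyIntegrable : IsL1LocClosure u
  eq : ∀ φ : Space N → ℝ, IsD0 φ →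
    -μ.integral (fun x => φ x) + ν.integral (fun x' => partialD none φ (x', 0)) =
      ∫ x in halfSpace N, u x * (-laplace φ x)

/-! For smooth `φ` vanishing on the boundary, test `Δu = μ` with `φ E(x_N)`, where `E(t) = η(t/ε)`
vanishes for `t ≤ ε` and equals `1` for `t ≥ 2ε`. Then `Δ(φE) = Δφ E + 2 ∂_Nφ E' + φ E''`. With
`θ(x') = ∂_Nφ(x',0)`, Taylor expansion in `x_N` replaces `∂_Nφ` by `θ` and `φ` by `x_N θ`. The
errors are `O(x_N)` against `E' = O(1/ε)` and `O(x_N²)` against `E'' = O(1/ε²)`. They are therefore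
bounded and live on `ε ≤ x_N ≤ 2ε`, and they disappear in the limit because `u` is integrable up to
the boundary. What remains is `θ(x') R'(x_N)` with `R = (tE)' = E + tE'`, and `R'` is a kernel of
mass one concentrating at `0⁺`. By the lim-trace hypothesis its integral against `u` tends to `∫ θ
dν`. On the other side `|φ| ≤ C x_N` makes `∫ φE dμ` converge. This is `smooth_weak_equation`.

Two points need care. Traces are defined height by height as limits of smooth functions, so the
slicing formula for `∫ u θ R'` must be proved (`integral_trace_mul_deriv`): write each trace
integral as a volume integral over `{x_N > t}`, apply Fubini, then use the definition of the weak
derivative. Moreover, for `φ` merely `C²` neither is `φE` an admissible test function nor `θ` a `C²`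
function, so `exists_smooth_approx` first reduces to smooth `φ`. -/

/-! ### Partial derivatives, Laplacians and Taylor bounds in the normal direction -/

section Calculus

variable {N : ℕ}

lemma contDiff_partialD {m n : WithTop ℕ∞} {f : Space N → ℝ} (hf : ContDiff ℝ n f) (h : m + 1 ≤ n)
    (j : Option (Fin (N - 1))) : ContDiff ℝ m (partialD j f) :=
  (hf.fderiv_right h).clm_apply contDiff_const

lemma hasCompactSupport_partialD {f : Space N → ℝ} (hf : HasCompactSupport f)
    (j : Option (Fin (N - 1))) : HasCompactSupport (partialD j f) :=
  hf.fderiv_apply ℝ _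

lemma continuous_laplace {f : Space N → ℝ} (hf : ContDiff ℝ 2 f) : Continuous (laplace f) := by
  unfold laplace
  exact continuous_finsetSum _ fun j _ =>
    (contDiff_partialD (m := 0) (contDiff_partialD (m := 1) hf (by norm_num) j)
      (by norm_num) j).continuous

lemma partialD_eq_zero_of_eventuallyEq {f : Space N → ℝ} {x : Space N} (h : f =ᶠ[𝓝 x] 0)
    (j : Option (Fin (N - 1))) : partialD j f =ᶠ[𝓝 x] 0 := by
  filter_upwards [h.eventuallyEq_nhds] with y hy
  simp [partialD, hy.fderiv_eq]

lemma laplace_eq_zero_of_eventuallyEq {f : Space N → ℝ} {x : Space N} (h : f =ᶠ[𝓝 x] 0) :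
    laplace f x = 0 := by
  unfold laplace
  exact Finset.sum_eq_zero fun j _ =>
    (partialD_eq_zero_of_eventuallyEq (partialD_eq_zero_of_eventuallyEq h j) j).eq_of_nhds

lemma partialD_eq_zero_of_notMem {f : Space N → ℝ} {x : Space N} (h : x ∉ tsupport f)
    (j : Option (Fin (N - 1))) : partialD j f x = 0 :=
  (partialD_eq_zero_of_eventuallyEq (notMem_tsupport_iff_eventuallyEq.mp h) j).eq_of_nhds

lemma laplace_eq_zero_of_notMem {f : Space N → ℝ} {x : Space N} (h : x ∉ tsupport f) :
    laplace f x = 0 :=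
  laplace_eq_zero_of_eventuallyEq (notMem_tsupport_iff_eventuallyEq.mp h)

lemma hasDerivAt_slice {f : Space N → ℝ} (hf : Differentiable ℝ f) (x' : Bdry N) (t : ℝ) :
    HasDerivAt (fun s => f (x', s)) (partialD none f (x', t)) t := by
  have h1 : HasDerivAt (fun s : ℝ => ((x', s) : Space N)) ((0, 1) : Space N) t :=
    (hasDerivAt_const t x').prodMk (hasDerivAt_id t)
  exact (hf (x', t)).hasFDerivAt.comp_hasDerivAt t h1

lemma partialD_sub {f g : Space N → ℝ} (hf : Differentiable ℝ f) (hg : Differentiable ℝ g)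
    (j : Option (Fin (N - 1))) :
    partialD j (fun x => f x - g x) = fun x => partialD j f x - partialD j g x := by
  funext x
  simp only [partialD]
  rw [fderiv_fun_sub (hf x) (hg x)]
  rfl

lemma laplace_sub {f g : Space N → ℝ} (hf : ContDiff ℝ 2 f) (hg : ContDiff ℝ 2 g) (x : Space N) :
    laplace (fun x => f x - g x) x = laplace f x - laplace g x := by
  unfold laplace
  rw [← Finset.sum_sub_distrib]
  refine Finset.sum_congr rfl fun j _ => ?_
  rw [partialD_sub (hf.differentiable (by norm_num)) (hg.differentiable (by norm_num)),
    partialD_sub ((contDiff_partialD (m := 1) hf (by norm_num) j).differentiable (by norm_num))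
      ((contDiff_partialD (m := 1) hg (by norm_num) j).differentiable (by norm_num))]

lemma hasFDerivAt_mul_snd {f : Space N → ℝ} {h : ℝ → ℝ} (hf : Differentiable ℝ f)
    (hh : Differentiable ℝ h) (x : Space N) :
    HasFDerivAt (fun x : Space N => f x * h x.2)
      (f x • (deriv h x.2 • ContinuousLinearMap.snd ℝ (Bdry N) ℝ) + h x.2 • fderiv ℝ f x) x :=
  (hf x).hasFDerivAt.mul ((hh x.2).hasDerivAt.comp_hasFDerivAt x hasFDerivAt_snd)

lemma partialD_some_mul_snd {f : Space N → ℝ} {h : ℝ → ℝ} (hf : Differentiable ℝ f)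
    (hh : Differentiable ℝ h) (i : Fin (N - 1)) :
    partialD (some i) (fun x : Space N => f x * h x.2) =
      fun x => partialD (some i) f x * h x.2 := by
  funext x
  simp [partialD, (hasFDerivAt_mul_snd hf hh x).fderiv, stdVec, mul_comm]

lemma partialD_none_mul_snd {f : Space N → ℝ} {h : ℝ → ℝ} (hf : Differentiable ℝ f)
    (hh : Differentiable ℝ h) :
    partialD none (fun x : Space N => f x * h x.2) =
      fun x => partialD none f x * h x.2 + f x * deriv h x.2 := by
  funext x
  simp [partialD, (hasFDerivAt_mul_snd hf hh x).fderiv, stdVec]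
  ring

lemma laplace_mul_snd {f : Space N → ℝ} {h : ℝ → ℝ} (hf : ContDiff ℝ 2 f) (hh : ContDiff ℝ 2 h)
    (x : Space N) :
    laplace (fun x : Space N => f x * h x.2) x =
      laplace f x * h x.2 + 2 * partialD none f x * deriv h x.2
        + f x * deriv (deriv h) x.2 := by
  have hf1 : Differentiable ℝ f := hf.differentiable (by norm_num)
  have hh1 : Differentiable ℝ h := hh.differentiable (by norm_num)
  have hh2 : Differentiable ℝ (deriv h) := by
    have : ContDiff ℝ 1 (deriv h) := by
      have := (contDiff_succ_iff_deriv (n := 1)).1 (by simpa [one_add_one_eq_two] using hh)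
      exact this.2.2
    exact this.differentiable (by norm_num)
  have hp : ∀ j, Differentiable ℝ (partialD j f) := fun j =>
    (contDiff_partialD (m := 1) hf (by norm_num) j).differentiable (by norm_num)
  have hadd : ∀ {a b : Space N → ℝ}, Differentiable ℝ a → Differentiable ℝ b →
      partialD none (fun x => a x + b x) x = partialD none a x + partialD none b x := by
    intro a b ha hb
    simp only [partialD]
    rw [fderiv_fun_add (ha x) (hb x)]
    rfl
  simp only [laplace, Fintype.sum_option]
  rw [partialD_none_mul_snd hf1 hh1, hadd, partialD_none_mul_snd (hp none) hh1,
    partialD_none_mul_snd hf1 hh2]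
  · simp only [partialD_some_mul_snd hf1 hh1, partialD_some_mul_snd (hp _) hh1]
    rw [add_mul, Finset.sum_mul]
    ring
  · exact (hp none).mul (hh1.comp differentiable_snd)
  · exact hf1.mul (hh2.comp differentiable_snd)

lemma hasFDerivAt_fst_zero {f : Space N → ℝ} (hf : Differentiable ℝ f) (x : Space N) :
    HasFDerivAt (fun x : Space N => f (x.1, 0))
      ((fderiv ℝ f (x.1, 0)).comp
        ((ContinuousLinearMap.fst ℝ (Bdry N) ℝ).prod (0 : Space N →L[ℝ] ℝ))) x :=
  (hf (x.1, 0)).hasFDerivAt.comp x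
    ((hasFDerivAt_fst (p := x)).prodMk (hasFDerivAt_const (0 : ℝ) x))

lemma partialD_some_fst_zero {f : Space N → ℝ} (hf : Differentiable ℝ f) (i : Fin (N - 1)) :
    partialD (some i) (fun x : Space N => f (x.1, 0)) = fun x => partialD (some i) f (x.1, 0) := by
  funext x
  simp [partialD, (hasFDerivAt_fst_zero hf x).fderiv, stdVec]

lemma partialD_none_fst_zero {f : Space N → ℝ} (hf : Differentiable ℝ f) :
    partialD none (fun x : Space N => f (x.1, 0)) = 0 := by
  funext x
  simp only [partialD, (hasFDerivAt_fst_zero hf x).fderiv, stdVec]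
  exact (fderiv ℝ f (x.1, 0)).map_zero

lemma partialD_zero (j : Option (Fin (N - 1))) : partialD j (0 : Space N → ℝ) = 0 := by
  funext x
  simp [partialD]

lemma contDiff_fst_zero {n : WithTop ℕ∞} {f : Space N → ℝ} (hf : ContDiff ℝ n f) :
    ContDiff ℝ n (fun x : Space N => f (x.1, 0)) :=
  hf.comp (contDiff_fst.prodMk contDiff_const)

/-- The extension of boundary values constant in `x_N` serves to correct approximants that fail to
vanish on the boundary; only tangential derivatives survive. -/
lemma laplace_fst_zero {f : Space N → ℝ} (hf : ContDiff ℝ 2 f) (x : Space N) :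
    laplace (fun x : Space N => f (x.1, 0)) x =
      ∑ i, partialD (some i) (partialD (some i) f) (x.1, 0) := by
  have hf1 : Differentiable ℝ f := hf.differentiable (by norm_num)
  have hp : ∀ j, Differentiable ℝ (partialD j f) := fun j =>
    (contDiff_partialD (m := 1) hf (by norm_num) j).differentiable (by norm_num)
  simp only [laplace, Fintype.sum_option]
  simp only [partialD_none_fst_zero hf1, partialD_zero, partialD_some_fst_zero hf1,
    partialD_some_fst_zero (hp _)]
  simp

lemma exists_bound_of_hasCompactSupport {f : Space N → ℝ} (hf : Continuous f)
    (hc : HasCompactSupport f) : ∃ C, 0 ≤ C ∧ ∀ x, |f x| ≤ C := by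
  obtain ⟨C, hC⟩ := hc.exists_bound_of_continuous hf
  exact ⟨C, (norm_nonneg _).trans (hC 0), hC⟩

lemma abs_sub_boundary_le {f : Space N → ℝ} (hf : Differentiable ℝ f) {C : ℝ} {x' : Bdry N}
    {s : ℝ} (hs : 0 ≤ s) (hC : ∀ t ∈ Set.Icc 0 s, |partialD none f (x', t)| ≤ C) :
    |f (x', s) - f (x', 0)| ≤ C * s := by
  have := norm_image_sub_le_of_norm_deriv_le_segment' (f := fun t => f (x', t)) (a := 0) (b := s)
    (C := C) (fun t _ => (hasDerivAt_slice hf x' t).hasDerivWithinAt)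
    (fun t ht => hC t ⟨ht.1, ht.2.le⟩) s ⟨hs, le_rfl⟩
  simpa using this

/-- Two applications of the mean value inequality; the sharp constant `C / 2` is not needed. -/
lemma abs_sub_taylor_le {f : Space N → ℝ} (hf : ContDiff ℝ 2 f) {C : ℝ}
    (hC : ∀ x, |partialD none (partialD none f) x| ≤ C) (x' : Bdry N) {s : ℝ} (hs : 0 ≤ s)
    (h0 : f (x', 0) = 0) :
    |f (x', s) - s * partialD none f (x', 0)| ≤ C * s * s := by
  have hf1 : Differentiable ℝ f := hf.differentiable (by norm_num)
  have hp : Differentiable ℝ (partialD none f) :=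
    (contDiff_partialD (m := 1) hf (by norm_num) none).differentiable (by norm_num)
  have hC0 : 0 ≤ C := (abs_nonneg _).trans (hC (x', 0))
  have := norm_image_sub_le_of_norm_deriv_le_segment'
    (f := fun t => f (x', t) - t * partialD none f (x', 0)) (a := 0) (b := s)
    (f' := fun t => partialD none f (x', t) - 1 * partialD none f (x', 0)) (C := C * s)
    (fun t _ => ((hasDerivAt_slice hf1 x' t).sub
      ((hasDerivAt_id t).mul_const _)).hasDerivWithinAt)
    (fun t ht => by
      rw [one_mul]
      exact (abs_sub_boundary_le hp ht.1 fun t _ => hC _).trans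
        (mul_le_mul_of_nonneg_left ht.2.le hC0)) s ⟨hs, le_rfl⟩
  simpa [h0] using this

end Calculus

/-! ### Dominated convergence for the three integrals of the weak equation -/

section Convergence

variable {N : ℕ}

lemma isOpen_halfSpace : IsOpen (halfSpace N) := isOpen_lt continuous_const continuous_snd

lemma LocalRadonMeasure.integral_tendsto {X : Type*} [TopologicalSpace X] [MeasurableSpace X]
    (μ : LocalRadonMeasure X) {f : ℕ → X → ℝ} {g bound : X → ℝ}
    (hf : ∀ (m : Measure X) n, AEStronglyMeasurable (f n) m) (hbound : Integrable bound μ.abs)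
    (hle : ∀ n x, |f n x| ≤ bound x) (hlim : ∀ x, Tendsto (fun n => f n x) atTop (𝓝 (g x))) :
    Tendsto (fun n => μ.integral (f n)) atTop (𝓝 (μ.integral g)) := by
  have key : ∀ m : Measure X, m ≤ μ.abs →
      Tendsto (fun n => ∫ x, f n x ∂m) atTop (𝓝 (∫ x, g x ∂m)) := fun m hm =>
    tendsto_integral_of_dominated_convergence bound (hf m) (hbound.mono_measure hm)
      (fun n => Eventually.of_forall (hle n)) (Eventually.of_forall hlim)
  exact (key _ (Measure.le_add_right le_rfl)).sub (key _ (Measure.le_add_left le_rfl))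

lemma IsWeighted.integrable_bound {μ : LocalRadonMeasure (halfSpace N)} (hμ : IsWeighted μ)
    (C R : ℝ) :
    Integrable ({x : halfSpace N | (x : Space N) ∈ Metric.closedBall 0 R}.indicator
      fun x => C * (x : Space N).2) μ.abs := by
  have hm : Measurable fun x : halfSpace N => (x : Space N).2 :=
    measurable_snd.comp measurable_subtype_coe
  refine IntegrableOn.integrable_indicator (Integrable.const_mul ⟨hm.aestronglyMeasurable, ?_⟩ _)
    (measurable_subtype_coe Metric.isClosed_closedBall.measurableSet)
  refine lt_of_eq_of_lt (lintegral_congr fun x => ?_)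
    (hμ {x : halfSpace N | (x : Space N) ∈ Metric.closedBall 0 R} ?_)
  · exact Real.enorm_of_nonneg (le_of_lt x.2)
  · exact isometry_subtype_coe.antilipschitz.isBounded_preimage Metric.isBounded_closedBall

/-- The majorant is `C x_N` on a ball, which is `|μ|`-integrable exactly by the weight condition;
`|μ|` itself may be infinite near the boundary. -/
lemma IsWeighted.integral_tendsto {μ : LocalRadonMeasure (halfSpace N)} (hμ : IsWeighted μ)
    {f : ℕ → Space N → ℝ} {g : Space N → ℝ} (hf : ∀ n, Continuous (f n)) {C R : ℝ}
    (hle : ∀ n x, 0 < x.2 → |f n x| ≤ C * x.2)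
    (hsupp : ∀ n x, x ∉ Metric.closedBall 0 R → f n x = 0)
    (hlim : ∀ x, 0 < x.2 → Tendsto (fun n => f n x) atTop (𝓝 (g x))) :
    Tendsto (fun n => μ.integral fun x => f n x) atTop (𝓝 (μ.integral fun x => g x)) := by
  refine μ.integral_tendsto (fun m n => ?_) (hμ.integrable_bound C R) (fun n x => ?_)
    (fun x => hlim x x.2)
  · exact ((hf n).measurable.comp measurable_subtype_coe).aestronglyMeasurable
  · by_cases hx : (x : Space N) ∈ Metric.closedBall 0 R
    · rw [Set.indicator_of_mem (by exact hx)]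
      exact hle n x x.2
    · rw [Set.indicator_of_notMem (by exact hx), hsupp n x hx, abs_zero]

lemma IsL1LocClosure.integrableOn_closedBall {u : Space N → ℝ} (hu : IsL1LocClosure u) (R : ℝ) :
    IntegrableOn u (halfSpace N ∩ Metric.closedBall 0 R) :=
  (hu (halfSpace N ∩ Metric.ball 0 (R + 1)) (isOpen_halfSpace.inter Metric.isOpen_ball)
    (Metric.isBounded_ball.subset Set.inter_subset_right) Set.inter_subset_left).mono_set
    (Set.inter_subset_inter_right _ (Metric.closedBall_subset_ball (by linarith)))

lemma IsL1LocClosure.integrable_mul {u : Space N → ℝ} (hu : IsL1LocClosure u)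
    {f : Space N → ℝ} (hf : Continuous f) {C R : ℝ}
    (hle : ∀ x, 0 < x.2 → |f x| ≤ C)
    (hsupp : ∀ x, 0 < x.2 → x ∉ Metric.closedBall 0 R → f x = 0) :
    IntegrableOn (fun x => u x * f x) (halfSpace N) := by
  have h1 : IntegrableOn (fun x => u x * f x) (halfSpace N ∩ Metric.closedBall 0 R) := by
    refine Integrable.mul_bdd (c := C) (hu.integrableOn_closedBall R)
      hf.aestronglyMeasurable ?_
    filter_upwards [ae_restrict_mem
      (isOpen_halfSpace.measurableSet.inter Metric.isClosed_closedBall.measurableSet)] with x hx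
    exact hle x hx.1
  refine h1.of_forall_sdiff_eq_zero isOpen_halfSpace.measurableSet fun x hx => ?_
  rw [hsupp x hx.1 fun h => hx.2 ⟨hx.1, h⟩, mul_zero]

lemma IsL1LocClosure.integral_tendsto {u : Space N → ℝ} (hu : IsL1LocClosure u)
    {f : ℕ → Space N → ℝ} {g : Space N → ℝ} (hf : ∀ n, Continuous (f n)) {C R : ℝ}
    (hle : ∀ n x, 0 < x.2 → |f n x| ≤ C)
    (hsupp : ∀ n x, 0 < x.2 → x ∉ Metric.closedBall 0 R → f n x = 0)
    (hlim : ∀ x, 0 < x.2 → Tendsto (fun n => f n x) atTop (𝓝 (g x))) :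
    Tendsto (fun n => ∫ x in halfSpace N, u x * f n x) atTop
      (𝓝 (∫ x in halfSpace N, u x * g x)) := by
  have hb : Integrable ((Metric.closedBall 0 R).indicator fun x => |u x| * C)
      (volume.restrict (halfSpace N)) := by
    rw [integrable_indicator_iff Metric.isClosed_closedBall.measurableSet, IntegrableOn,
      Measure.restrict_restrict Metric.isClosed_closedBall.measurableSet, Set.inter_comm]
    exact (hu.integrableOn_closedBall R).abs.mul_const C
  refine tendsto_integral_of_dominated_convergence _
    (fun n => (hu.integrable_mul (hf n) (hle n) (hsupp n)).aestronglyMeasurable) hb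
    (fun n => ?_) ?_
  · filter_upwards [ae_restrict_mem isOpen_halfSpace.measurableSet] with x hx
    by_cases h : x ∈ Metric.closedBall 0 R
    · rw [Set.indicator_of_mem h, Real.norm_eq_abs, abs_mul]
      exact mul_le_mul_of_nonneg_left (hle n x hx) (abs_nonneg _)
    · simp [Set.indicator_of_notMem h, hsupp n x hx h]
  · filter_upwards [ae_restrict_mem isOpen_halfSpace.measurableSet] with x hx
    exact (hlim x hx).const_mul _

lemma boundary_integral_tendsto (ν : LocalRadonMeasure (Bdry N))
    {f : ℕ → Bdry N → ℝ} {g : Bdry N → ℝ} (hf : ∀ n, Continuous (f n)) {C R : ℝ}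
    (hle : ∀ n x, |f n x| ≤ C) (hsupp : ∀ n x, x ∉ Metric.closedBall 0 R → f n x = 0)
    (hlim : ∀ x, Tendsto (fun n => f n x) atTop (𝓝 (g x))) :
    Tendsto (fun n => ν.integral (f n)) atTop (𝓝 (ν.integral g)) := by
  have hp := ν.posPart_regular
  have hn := ν.negPart_regular
  refine ν.integral_tendsto (bound := (Metric.closedBall 0 R).indicator fun _ => C)
    (fun m n => (hf n).aestronglyMeasurable) ?_ (fun n x => ?_) hlim
  · have hfin : ∀ m : Measure (Bdry N), IsFiniteMeasureOnCompacts m →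
        IntegrableOn (fun _ => C) (Metric.closedBall (0 : Bdry N) R) m := fun m _ =>
      continuous_const.continuousOn.integrableOn_compact (isCompact_closedBall 0 R)
    rw [integrable_indicator_iff Metric.isClosed_closedBall.measurableSet]
    exact (hfin _ inferInstance).add_measure (hfin _ inferInstance)
  · by_cases hx : x ∈ Metric.closedBall 0 R
    · rw [Set.indicator_of_mem hx]
      exact hle n x
    · rw [Set.indicator_of_notMem hx, hsupp n x hx, abs_zero]

end Convergence

/-! ### Smooth approximation preserving the zero boundary values -/

section Mollification

variable {N : ℕ}

instance : (volume : Measure (Space N)).IsAddHaarMeasure :=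
  inferInstanceAs ((volume : Measure (Bdry N)).prod (volume : Measure ℝ)).IsAddHaarMeasure

/-- Mollification of `f` by a bump function centered at the origin. -/
noncomputable def mollify (ρ : ContDiffBump (0 : Space N)) (f : Space N → ℝ) : Space N → ℝ :=
  convolution (ρ.normed volume) f (ContinuousLinearMap.lsmul ℝ ℝ) volume

lemma contDiff_mollify (ρ : ContDiffBump (0 : Space N)) {f : Space N → ℝ} (hf : Continuous f) :
    ContDiff ℝ ∞ (mollify ρ f) :=
  ρ.hasCompactSupport_normed.contDiff_convolution_left _ ρ.contDiff_normed hf.locallyIntegrable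

lemma partialD_mollify (ρ : ContDiffBump (0 : Space N)) {f : Space N → ℝ} (hf : ContDiff ℝ 1 f)
    (hc : HasCompactSupport f) (j : Option (Fin (N - 1))) :
    partialD j (mollify ρ f) = mollify ρ (partialD j f) := by
  have hρ : LocallyIntegrable (ρ.normed volume) (volume : Measure (Space N)) :=
    ρ.continuous_normed.locallyIntegrable
  funext x
  simp only [partialD, mollify]
  rw [(hc.hasFDerivAt_convolution_right _ hρ hf x).fderiv,
    convolution_precompR_apply _ hρ (hc.fderiv ℝ) (hf.continuous_fderiv one_ne_zero)]
  rfl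

/-- The mollification differs from `f x` by at most the oscillation `2 * C`, and `|f x| ≤ C`. The
constant `3` is not sharp; only its independence of `ρ` matters. -/
lemma abs_mollify_le (ρ : ContDiffBump (0 : Space N)) {f : Space N → ℝ} (hf : Continuous f)
    {C : ℝ} (hC : ∀ x, |f x| ≤ C) (x : Space N) : |mollify ρ f x| ≤ 3 * C := by
  have h := ρ.dist_normed_convolution_le (μ := volume) (x₀ := x) (ε := 2 * C)
    hf.aestronglyMeasurable (fun y _ => by
      rw [Real.dist_eq]
      linarith [abs_sub (f y) (f x), hC x, hC y])
  rw [Real.dist_eq] at h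
  have h2 := abs_sub_abs_le_abs_sub (mollify ρ f x) (f x)
  have h3 := hC x
  unfold mollify at *
  linarith

lemma mollify_eq_zero (ρ : ContDiffBump (0 : Space N)) {f : Space N → ℝ} {R : ℝ}
    (hf : ∀ x ∉ Metric.closedBall 0 R, f x = 0) (hρ : ρ.rOut ≤ 1) {x : Space N}
    (hx : x ∉ Metric.closedBall 0 (R + 1)) : mollify ρ f x = 0 := by
  rw [Metric.mem_closedBall, dist_zero_right, not_le] at hx
  have hz : ∀ y ∈ Metric.ball x ρ.rOut, f y = 0 := fun y hy => by
    refine hf y ?_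
    rw [Metric.mem_closedBall, dist_zero_right, not_le]
    have := norm_sub_norm_le x y
    rw [← dist_eq_norm, dist_comm] at this
    linarith [Metric.mem_ball.1 hy]
  have h0 : f x = 0 := hz x (Metric.mem_ball_self ρ.rOut_pos)
  unfold mollify
  rw [ρ.normed_convolution_eq_right (fun y hy => (hz y hy).trans h0.symm), h0]

lemma tendsto_mollify {ρ : ℕ → ContDiffBump (0 : Space N)}
    (hρ : Tendsto (fun n => (ρ n).rOut) atTop (𝓝 0)) {f : Space N → ℝ} (hf : Continuous f)
    (x : Space N) : Tendsto (fun n => mollify (ρ n) f x) atTop (𝓝 (f x)) :=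
  ContDiffBump.convolution_tendsto_right_of_continuous hρ hf x

lemma exists_cutoff : ∃ χ : ℝ → ℝ, ContDiff ℝ ∞ χ ∧ χ 0 = 1 ∧ ∀ t, 1 < |t| → χ t = 0 := by
  let b : ContDiffBump (0 : ℝ) := ⟨1 / 2, 1, by norm_num, by norm_num⟩
  refine ⟨b, b.contDiff, b.one_of_mem_closedBall (by simp [b]), fun t ht => b.zero_of_le_dist ?_⟩
  simpa [b] using ht.le

/-- A `C²` function vanishing on the boundary is approximated by smooth ones, with uniformly
bounded supports and derivatives. -/
lemma exists_smooth_approx {φ : Space N → ℝ} (hφ : IsD0 φ) :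
    ∃ (ψ : ℕ → Space N → ℝ) (C R : ℝ), (∀ n, ContDiff ℝ ∞ (ψ n)) ∧ (∀ n x', ψ n (x', 0) = 0) ∧
      (∀ n, ∀ x ∉ Metric.closedBall 0 R, ψ n x = 0) ∧
      (∀ n x, |partialD none (ψ n) x| ≤ C) ∧ (∀ n x, |laplace (ψ n) x| ≤ C) ∧
      (∀ x, Tendsto (fun n => ψ n x) atTop (𝓝 (φ x))) ∧
      (∀ x, Tendsto (fun n => partialD none (ψ n) x) atTop (𝓝 (partialD none φ x))) ∧
      (∀ x, Tendsto (fun n => laplace (ψ n) x) atTop (𝓝 (laplace φ x))) := by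
  have hc := hφ.contDiff
  have hs := hφ.compactSupport
  have hd1 : ∀ j, ContDiff ℝ 1 (partialD j φ) := fun j => contDiff_partialD hc (by norm_num) j
  have hd2 : ∀ i j, Continuous (partialD i (partialD j φ)) := fun i j =>
    (contDiff_partialD (m := 0) (hd1 j) (by norm_num) i).continuous
  have hs1 : ∀ j, HasCompactSupport (partialD j φ) := hasCompactSupport_partialD hs
  have hs2 : ∀ i j, HasCompactSupport (partialD i (partialD j φ)) := fun i j =>
    hasCompactSupport_partialD (hs1 j) i
  -- `1 ≤ R` ensures that a point with `|x_N| ≤ 1` outside the ball of radius `R + 1` (in the max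
  -- norm) has `‖x'‖ > R + 1`.
  obtain ⟨R, hR1, hR⟩ : ∃ R, 1 ≤ R ∧ ∀ x ∉ Metric.closedBall 0 R, φ x = 0 := by
    obtain ⟨R, hR⟩ := hs.isCompact.isBounded.subset_closedBall 0
    exact ⟨max R 1, le_max_right _ _, fun x hx => image_eq_zero_of_notMem_tsupport fun h =>
      hx (Metric.closedBall_subset_closedBall (le_max_left _ _) (hR h))⟩
  obtain ⟨χ, hχ, hχ0, hχs⟩ := exists_cutoff
  have hχc : HasCompactSupport χ := HasCompactSupport.intro (isCompact_closedBall (0 : ℝ) 1)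
    fun t ht => hχs t (by simpa using ht)
  have hχ1 : ContDiff ℝ ∞ (deriv χ) := (contDiff_infty_iff_deriv.1 hχ).2
  have hχ2 : ContDiff ℝ ∞ (deriv (deriv χ)) := (contDiff_infty_iff_deriv.1 hχ1).2
  obtain ⟨D0, hD0⟩ := hχc.exists_bound_of_continuous hχ.continuous
  obtain ⟨D1, hD1⟩ := hχc.deriv.exists_bound_of_continuous hχ1.continuous
  obtain ⟨D2, hD2⟩ := hχc.deriv.deriv.exists_bound_of_continuous hχ2.continuous
  obtain ⟨C0, hC0n, hC0⟩ := exists_bound_of_hasCompactSupport hc.continuous hs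
  obtain ⟨C1, hC1n, hC1⟩ := exists_bound_of_hasCompactSupport (hd1 none).continuous (hs1 none)
  choose C2 hC2n hC2 using fun j => exists_bound_of_hasCompactSupport (hd2 j j) (hs2 j j)
  let ρ : ℕ → ContDiffBump (0 : Space N) := fun n =>
    ⟨1 / ((n : ℝ) + 1) / 2, 1 / ((n : ℝ) + 1), by positivity, half_lt_self (by positivity)⟩
  have hρ : Tendsto (fun n => (ρ n).rOut) atTop (𝓝 0) := tendsto_one_div_add_atTop_nhds_zero_nat
  have hρ1 : ∀ n, (ρ n).rOut ≤ 1 := fun n => by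
    simp only [ρ]
    rw [div_le_one (by positivity)]
    linarith [(Nat.cast_nonneg n : (0 : ℝ) ≤ n)]
  -- Mollifying destroys the zero boundary values; subtracting `S n (x', 0) χ(x_N)`, with `χ 0 = 1`,
  -- restores them.
  let S : ℕ → Space N → ℝ := fun n => mollify (ρ n) φ
  have hS : ∀ n, ContDiff ℝ ∞ (S n) := fun n => contDiff_mollify _ hc.continuous
  have hSd : ∀ n, Differentiable ℝ (S n) := fun n => (hS n).differentiable (by norm_num)
  have hS1 : ∀ n j, partialD j (S n) = mollify (ρ n) (partialD j φ) := fun n j =>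
    partialD_mollify _ (hc.of_le (by norm_num)) hs j
  have hS2 : ∀ n j, partialD j (partialD j (S n)) =
      mollify (ρ n) (partialD j (partialD j φ)) := fun n j => by
    rw [hS1, partialD_mollify _ (hd1 j) (hs1 j)]
  have hB : ∀ n, ContDiff ℝ ∞ fun x : Space N => S n (x.1, 0) := fun n => contDiff_fst_zero (hS n)
  have hχd : Differentiable ℝ χ := hχ.differentiable (by norm_num)
  have e2 : (2 : WithTop ℕ∞) ≤ ∞ := WithTop.coe_le_coe.2 (le_top : (2 : ℕ∞) ≤ ⊤)
  have hM : ∀ n, ContDiff ℝ ∞ fun x : Space N => S n (x.1, 0) * χ x.2 := fun n =>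
    (hB n).mul (hχ.comp contDiff_snd)
  have hP1 : ∀ n, partialD none (fun x : Space N => S n x - S n (x.1, 0) * χ x.2) =
      fun x => mollify (ρ n) (partialD none φ) x - S n (x.1, 0) * deriv χ x.2 := fun n => by
    rw [partialD_sub (hSd n) ((hM n).differentiable (by norm_num)),
      partialD_none_mul_snd ((hB n).differentiable (by norm_num))
      hχd, partialD_none_fst_zero (hSd n), hS1]
    simp
  have hP2 : ∀ n x, laplace (fun x : Space N => S n x - S n (x.1, 0) * χ x.2) x =
      ∑ j, mollify (ρ n) (partialD j (partialD j φ)) x -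
        ((∑ i, mollify (ρ n) (partialD (some i) (partialD (some i) φ)) (x.1, 0)) * χ x.2
          + S n (x.1, 0) * deriv (deriv χ) x.2) := fun n x => by
    rw [laplace_sub ((hS n).of_le e2) ((hM n).of_le e2),
      laplace_mul_snd ((hB n).of_le e2) (hχ.of_le e2), laplace_fst_zero ((hS n).of_le e2),
      partialD_none_fst_zero (hSd n)]
    simp [laplace, hS2]
  -- Since `φ` vanishes identically on the boundary, so do its tangential second derivatives. Hence
  -- the Laplacian of the correction tends to `0`.
  have hbd : ∀ i x', partialD (some i) (partialD (some i) φ) (x', 0) = 0 := fun i x' => by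
    have h0 : (fun x : Space N => φ (x.1, 0)) = 0 := funext fun x => hφ.boundary x.1
    have h1 := partialD_some_fst_zero (hc.differentiable (by norm_num)) i
    rw [h0, partialD_zero] at h1
    have h2 := partialD_some_fst_zero ((hd1 (some i)).differentiable (by norm_num)) i
    rw [← h1, partialD_zero] at h2
    exact (congrFun h2 (x', 0)).symm
  have hSb : ∀ x : Space N, Tendsto (fun n => S n (x.1, 0)) atTop (𝓝 0) := fun x => by
    simpa only [hφ.boundary] using tendsto_mollify hρ hc.continuous (x.1, 0)
  refine ⟨fun n x => S n x - S n (x.1, 0) * χ x.2,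
    max (3 * C1 + 3 * C0 * D1) (∑ j, 3 * C2 j + ((∑ i, 3 * C2 (some i)) * D0 + 3 * C0 * D2)),
    R + 1, fun n => (hS n).sub (hM n), fun n x' => by simp [hχ0],
    fun n x hx => ?_, fun n x => ?_, fun n x => ?_, fun x => ?_, fun x => ?_, fun x => ?_⟩
  · have h1 : S n x = 0 := mollify_eq_zero _ hR (hρ1 n) hx
    by_cases h2 : 1 < |x.2|
    · simp [h1, hχs _ h2]
    · have h3 : S n (x.1, 0) = 0 := by
        refine mollify_eq_zero _ hR (hρ1 n) ?_
        rw [Metric.mem_closedBall, dist_zero_right, not_le, Prod.norm_def] at hx ⊢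
        rcases lt_max_iff.1 hx with h | h
        · exact lt_max_of_lt_left h
        · rw [Real.norm_eq_abs] at h
          linarith
      simp [h1, h3]
  · rw [hP1]
    refine (abs_sub _ _).trans (le_max_of_le_left (add_le_add ?_ ?_))
    · exact abs_mollify_le _ (hd1 none).continuous hC1 x
    · rw [abs_mul]
      exact mul_le_mul (abs_mollify_le _ hc.continuous hC0 _) (hD1 _) (abs_nonneg _) (by positivity)
  · rw [hP2]
    refine (abs_sub _ _).trans (le_max_of_le_right (add_le_add ?_ ((abs_add_le _ _).trans
      (add_le_add ?_ ?_))))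
    · exact (Finset.abs_sum_le_sum_abs _ _).trans
        (Finset.sum_le_sum fun j _ => abs_mollify_le _ (hd2 j j) (hC2 j) x)
    · rw [abs_mul]
      refine mul_le_mul ?_ (hD0 _) (abs_nonneg _)
        (Finset.sum_nonneg fun i _ => mul_nonneg (by norm_num) (hC2n _))
      exact (Finset.abs_sum_le_sum_abs _ _).trans
        (Finset.sum_le_sum fun j _ => abs_mollify_le _ (hd2 _ _) (hC2 _) _)
    · rw [abs_mul]
      exact mul_le_mul (abs_mollify_le _ hc.continuous hC0 _) (hD2 _) (abs_nonneg _) (by positivity)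
  · simpa using (tendsto_mollify hρ hc.continuous x).sub ((hSb x).mul_const (χ x.2))
  · simp only [hP1]
    simpa using (tendsto_mollify hρ (hd1 none).continuous x).sub
      ((hSb x).mul_const (deriv χ x.2))
  · simp only [hP2]
    have h1 := tendsto_finsetSum Finset.univ fun j (_ : j ∈ Finset.univ) =>
      tendsto_mollify hρ (hd2 j j) x
    have h2 := tendsto_finsetSum Finset.univ fun i (_ : i ∈ Finset.univ) =>
      tendsto_mollify hρ (hd2 (some i) (some i)) (x.1, 0)
    simp only [hbd, Finset.sum_const_zero] at h2
    simpa [laplace] using h1.sub ((h2.mul_const (χ x.2)).add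
      ((hSb x).mul_const (deriv (deriv χ) x.2)))

end Mollification

/-! ### Sobolev traces as volume integrals and the slicing formula -/

section Trace

variable {N : ℕ}

/-- Fubini and the fundamental theorem of calculus on each vertical half-line. The volume integral,
unlike the slice, is stable under local `L^p` limits. -/
lemma integral_slice_eq_neg {G : Space N → ℝ} (hG : ContDiff ℝ 1 G) (hc : HasCompactSupport G)
    (t : ℝ) :
    ∫ x', G (x', t) = -∫ x in {x : Space N | t < x.2}, partialD none G x := by
  have hset : {x : Space N | t < x.2} = Set.univ ×ˢ Set.Ioi t := by
    ext x
    simp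
  have hi : Integrable (partialD none G) :=
    (contDiff_partialD (m := 0) hG (by norm_num) none).continuous.integrable_of_hasCompactSupport
      (hasCompactSupport_partialD hc none)
  have hsl : ∀ x', ∫ s in Set.Ioi t, partialD none G (x', s) = -G (x', t) := fun x' => by
    have h1 : ContDiff ℝ 1 fun s => G (x', s) := hG.comp (contDiff_const.prodMk contDiff_id)
    have h2 : HasCompactSupport fun s => G (x', s) := by
      refine HasCompactSupport.intro (hc.isCompact.image continuous_snd) fun s hs => ?_
      exact image_eq_zero_of_notMem_tsupport fun h => hs ⟨(x', s), h, rfl⟩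
    rw [← h2.integral_Ioi_deriv_eq h1 t]
    exact integral_congr_ae (Eventually.of_forall fun s =>
      (hasDerivAt_slice (hG.differentiable (by norm_num)) x' s).deriv.symm)
  rw [hset, Measure.volume_eq_prod, setIntegral_prod _ hi.integrableOn]
  simp [hsl, integral_neg]

lemma integrableOn_mul_of_integrableOn_compact {X : Type*} [TopologicalSpace X] [T2Space X]
    [MeasurableSpace X] [BorelSpace X] [SecondCountableTopology X] {m : Measure X} {B K : Set X}
    {h w : X → ℝ} (hB : MeasurableSet B) (hK : IsCompact K) (hw : IntegrableOn w K m)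
    (hh : Continuous h) (h0 : ∀ x ∈ B, x ∉ K → h x = 0) :
    IntegrableOn (fun x => h x * w x) B m := by
  have h1 : IntegrableOn (fun x => h x * w x) (B ∩ K) m :=
    (hw.continuousOn_mul hh.continuousOn hK).mono_set Set.inter_subset_right
  refine h1.of_forall_sdiff_eq_zero hB fun x hx => ?_
  rw [h0 x hx.1 fun h => hx.2 ⟨hx.1, h⟩, zero_mul]

/-- On the compact set `K`, of finite measure, `L^p` convergence implies `L¹` convergence, and `h`
is bounded there. -/
lemma TendstoLpLoc.integral_mul {X : Type*} [TopologicalSpace X] [T2Space X] [MeasureSpace X]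
    [BorelSpace X] [SecondCountableTopology X]
    [IsFiniteMeasureOnCompacts (volume : Measure X)] {p : ENNReal} (hp : 1 ≤ p) {A B K : Set X}
    {v : ℕ → X → ℝ} {u h : X → ℝ} (hvu : TendstoLpLoc p A v u) (hv : ∀ k, Continuous (v k))
    (hB : MeasurableSet B) (hK : IsCompact K) (hKA : K ⊆ A) (hu : IntegrableOn u K)
    (hh : Continuous h) (h0 : ∀ x ∈ B, x ∉ K → h x = 0) :
    Tendsto (fun k => ∫ x in B, h x * v k x) atTop (𝓝 (∫ x in B, h x * u x)) := by
  have hred : ∀ f : X → ℝ, ∫ x in B, h x * f x = ∫ x in B ∩ K, h x * f x := fun f => by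
    refine setIntegral_eq_of_subset_of_forall_sdiff_eq_zero hB Set.inter_subset_left fun x hx => ?_
    rw [h0 x hx.1 fun h => hx.2 ⟨hx.1, h⟩, zero_mul]
  simp only [hred]
  obtain ⟨C, hC⟩ := hK.exists_bound_of_continuousOn hh.continuousOn
  have hvK : ∀ k, IntegrableOn (v k) K := fun k => (hv k).continuousOn.integrableOn_compact hK
  refine tendsto_integral_of_L1' _ ?_ (Eventually.of_forall fun k => ?_) ?_
  · exact ((hu.continuousOn_mul hh.continuousOn hK).mono_set
      Set.inter_subset_right).aestronglyMeasurable
  · exact ((hvK k).continuousOn_mul hh.continuousOn hK).mono_set Set.inter_subset_right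
  · have hfin : volume.restrict K Set.univ ^ (1 / (1 : ENNReal).toReal - 1 / p.toReal) ≠ ⊤ := by
      refine ENNReal.rpow_ne_top_of_nonneg ?_ (by simpa using hK.measure_lt_top.ne)
      rcases eq_or_ne p ⊤ with rfl | hpt
      · simp
      · have : 1 ≤ p.toReal := by simpa using (ENNReal.toReal_le_toReal (by simp) hpt).2 hp
        simpa using inv_le_one_of_one_le₀ this
    have hlim := ENNReal.Tendsto.const_mul (a := ENNReal.ofReal C)
      (ENNReal.Tendsto.mul_const (hvu K hK hKA) (Or.inr hfin)) (Or.inr ENNReal.ofReal_ne_top)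
    simp only [zero_mul, mul_zero] at hlim
    refine tendsto_of_tendsto_of_tendsto_of_le_of_le tendsto_const_nhds hlim
      (fun _ => zero_le) fun k => ?_
    refine (eLpNorm_mono_measure _ (Measure.restrict_mono Set.inter_subset_right le_rfl)).trans
      ((eLpNorm_le_mul_eLpNorm_of_ae_le_mul (g := fun x => v k x - u x) (c := C) ?_ 1).trans
        (mul_le_mul_right (eLpNorm_le_eLpNorm_mul_rpow_measure_univ hp
          ((hvK k).sub hu).aestronglyMeasurable) _))
    refine (ae_restrict_iff' hK.measurableSet).2 (Eventually.of_forall fun x hx => ?_)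
    simp only [Pi.sub_apply, ← mul_sub, norm_mul]
    exact mul_le_mul_of_nonneg_right (hC x hx) (norm_nonneg _)

/-- The fundamental lemma of the calculus of variations. It is needed because each trace comes with
its own representative of the weak derivative. -/
lemma IsWeakPartial.ae_eq {j : Option (Fin (N - 1))} {u w w' : Space N → ℝ}
    (h : IsWeakPartial j u w) (h' : IsWeakPartial j u w') :
    ∀ᵐ x, x ∈ halfSpace N → w x = w' x := by
  have hres : ∀ {g f : Space N → ℝ}, tsupport g ⊆ halfSpace N →
      ∫ x, g x * f x = ∫ x in halfSpace N, f x * g x := fun {g f} hg => by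
    rw [setIntegral_eq_integral_of_forall_compl_eq_zero]
    · simp [mul_comm]
    · intro x hx
      rw [image_eq_zero_of_notMem_tsupport fun h => hx (hg h), mul_zero]
  have hli : LocallyIntegrableOn (fun x => w x - w' x) (halfSpace N) :=
    h.locallyIntegrable_deriv.sub h'.locallyIntegrable_deriv
  have := isOpen_halfSpace.ae_eq_zero_of_integral_contDiff_smul_eq_zero hli ?_
  · filter_upwards [this] with x hx hxh using sub_eq_zero.1 (hx hxh)
  intro g hg hgc hgs
  have hint : ∀ {f : Space N → ℝ}, LocallyIntegrableOn f (halfSpace N) →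
      IntegrableOn (fun x => f x * g x) (halfSpace N) := fun {f} hf => by
    simp only [mul_comm (f _)]
    exact integrableOn_mul_of_integrableOn_compact isOpen_halfSpace.measurableSet hgc
      (hf.integrableOn_compact_subset hgs hgc) hg.continuous
      fun x _ hx => image_eq_zero_of_notMem_tsupport hx
  simp only [smul_eq_mul]
  rw [hres hgs]
  simp only [sub_mul]
  rw [integral_sub (hint h.locallyIntegrable_deriv) (hint h'.locallyIntegrable_deriv), sub_eq_zero]
  exact neg_injective ((h.eq g ⟨hg, hgc, hgs⟩).symm.trans (h'.eq g ⟨hg, hgc, hgs⟩))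

/-- Points of a compact set at height at least `t`. -/
lemma isCompact_inter_le_snd {K : Set (Space N)} (hK : IsCompact K) (t : ℝ) :
    IsCompact (K ∩ {x | t ≤ x.2}) :=
  hK.inter_right (isClosed_le continuous_const continuous_snd)

lemma integrableOn_mul_lt_snd {w F : Space N → ℝ}
    (hw : LocallyIntegrableOn w (halfSpace N)) (hF : Continuous F) (hFc : HasCompactSupport F)
    {t : ℝ} (ht : 0 < t) : IntegrableOn (fun x => F x * w x) {x | t < x.2} :=
  integrableOn_mul_of_integrableOn_compact (isOpen_lt continuous_const continuous_snd).measurableSet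
    (isCompact_inter_le_snd hFc t) (hw.integrableOn_compact_subset
      (fun _ hx => ht.trans_le hx.2) (isCompact_inter_le_snd hFc t)) hF
    fun _ hx hxK => image_eq_zero_of_notMem_tsupport fun h => hxK ⟨h, show t ≤ _ from le_of_lt hx⟩

/-- For the smooth approximants `v k` this is `integral_slice_eq_neg` with `G = F v k`. All terms
pass to the limit, since the support of `F` meets `{x_N ≥ t}` in a compact subset of the open
half-space. -/
lemma IsSobolevTrace.integral_eq {p : ENNReal} (hp : 1 ≤ p) {u w : Space N → ℝ}
    (hw : IsWeakPartial none u w) {t : ℝ} (ht : 0 < t) {g : Bdry N → ℝ}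
    (hg : IsSobolevTrace p u t g) {F : Space N → ℝ} (hF : ContDiff ℝ ∞ F)
    (hFc : HasCompactSupport F) :
    ∫ x', F (x', t) * g x' =
      -∫ x in {x | t < x.2}, (F x * w x + partialD none F x * u x) := by
  obtain ⟨hgp, v, hv, hvu, hvw, hvg⟩ := hg
  obtain ⟨w', hw', hvw'⟩ := hvw none
  have hF1 : ContDiff ℝ ∞ (partialD none F) := contDiff_partialD hF (by simp) none
  have hF1c : HasCompactSupport (partialD none F) := hasCompactSupport_partialD hFc none
  have hv1 : ∀ k, ContDiff ℝ ∞ (partialD none (v k)) := fun k =>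
    contDiff_partialD (hv k) (by simp) none
  have hB : MeasurableSet {x : Space N | t < x.2} :=
    (isOpen_lt continuous_const continuous_snd).measurableSet
  have hsub : ∀ K : Set (Space N), K ∩ {x | t ≤ x.2} ⊆ halfSpace N := fun K x hx =>
    ht.trans_le hx.2
  have key : ∀ {f : ℕ → Space N → ℝ} {l h : Space N → ℝ}, TendstoLpLoc p (halfSpace N) f l →
      (∀ k, ContDiff ℝ ∞ (f k)) → LocallyIntegrableOn l (halfSpace N) → ContDiff ℝ ∞ h →
      HasCompactSupport h → Tendsto (fun k => ∫ x in {x : Space N | t < x.2}, h x * f k x) atTop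
        (𝓝 (∫ x in {x : Space N | t < x.2}, h x * l x)) := by
    intro f l h hfl hf hl hh hhc
    have hK := isCompact_inter_le_snd hhc t
    refine hfl.integral_mul hp (fun k => (hf k).continuous) hB hK (hsub _)
      (hl.integrableOn_compact_subset (hsub _) hK) hh.continuous fun x hx hxK => ?_
    exact image_eq_zero_of_notMem_tsupport fun h => hxK ⟨h, show t ≤ _ from le_of_lt hx⟩
  have hT : Tendsto (fun k => ∫ x', F (x', t) * v k (x', t)) atTop
      (𝓝 (∫ x', F (x', t) * g x')) := by
    have hK : IsCompact (Prod.fst '' tsupport F) := hFc.isCompact.image continuous_fst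
    have := hvg.integral_mul hp (B := Set.univ) (h := fun x' => F (x', t))
      (fun k => (hv k).continuous.comp (by fun_prop)) MeasurableSet.univ hK (Set.subset_univ _) ?_
      (hF.continuous.comp (by fun_prop))
      fun x _ hx => image_eq_zero_of_notMem_tsupport fun h => hx ⟨_, h, rfl⟩
    · simpa only [Measure.restrict_univ] using this
    · have : IsFiniteMeasure ((volume : Measure (Bdry N)).restrict (Prod.fst '' tsupport F)) :=
        ⟨by simpa using hK.measure_lt_top⟩
      exact (hgp _ hK (Set.subset_univ _)).integrable hp
  have hv_eq : ∀ k, ∫ x', F (x', t) * v k (x', t) =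
      -((∫ x in {x : Space N | t < x.2}, F x * partialD none (v k) x) +
        ∫ x in {x : Space N | t < x.2}, partialD none F x * v k x) := fun k => by
    rw [integral_slice_eq_neg (G := fun x => F x * v k x) ((hF.mul (hv k)).of_le (by simp))
      hFc.mul_right, ← integral_add]
    · congr 2
      funext x
      simp only [partialD]
      rw [fderiv_fun_mul (hF.differentiable (by norm_num) x)
        ((hv k).differentiable (by norm_num) x)]
      simp [mul_comm]
    · exact ((hF.continuous.mul (hv1 k).continuous).integrable_of_hasCompactSupport
        hFc.mul_right).integrableOn
    · exact ((hF1.continuous.mul (hv k).continuous).integrable_of_hasCompactSupport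
        hF1c.mul_right).integrableOn
  simp only [hv_eq] at hT
  rw [tendsto_nhds_unique hT ((key hvw' hv1 hw'.locallyIntegrable_deriv hF hFc).add
    (key hvu hv hw.locallyIntegrable hF1 hF1c)).neg, integral_add
      (integrableOn_mul_lt_snd hw.locallyIntegrable_deriv hF.continuous hFc ht)
      (integrableOn_mul_lt_snd hw.locallyIntegrable hF1.continuous hF1c ht)]
  congr 2
  refine setIntegral_congr_ae hB ?_
  filter_upwards [hw.ae_eq hw'] with x hx hxt
  rw [hx (ht.trans hxt)]

lemma hasCompactSupport_fst_mul_snd {θ : Bdry N → ℝ} {h : ℝ → ℝ} (hθ : HasCompactSupport θ)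
    (hh : HasCompactSupport h) : HasCompactSupport fun x : Space N => θ x.1 * h x.2 := by
  refine HasCompactSupport.intro (hθ.isCompact.prod hh.isCompact) fun x hx => ?_
  rw [Set.mem_prod, not_and_or] at hx
  rcases hx with hx | hx
  · rw [image_eq_zero_of_notMem_tsupport hx, zero_mul]
  · rw [image_eq_zero_of_notMem_tsupport hx, mul_zero]

/-- The slices of the Sobolev traces recover `u`, tested against `θ(x') R'(x_N)`. -/
lemma integral_trace_mul_deriv {p : ENNReal} (hp : 1 ≤ p) {u w : Space N → ℝ}
    (hw : IsWeakPartial none u w) {tr : ℝ → Bdry N → ℝ}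
    (htr : ∀ t, 0 < t → IsSobolevTrace p u t (tr t)) {θ : Bdry N → ℝ} (hθ : ContDiff ℝ ∞ θ)
    (hθc : HasCompactSupport θ) {R : ℝ → ℝ} {a b : ℝ} (ha : 0 < a) (hR : ContDiff ℝ ∞ R)
    (hR0 : ∀ t ≤ a, R t = 0) (hRb : ∀ t, b ≤ t → R t = R b) :
    Integrable (fun t => (∫ x', θ x' * tr t x') * deriv R t) ∧
      ∫ t, (∫ x', θ x' * tr t x') * deriv R t =
        ∫ x in halfSpace N, u x * (θ x.1 * deriv R x.2) := by
  have hρ : ContDiff ℝ ∞ (deriv R) := (contDiff_infty_iff_deriv.1 hR).2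
  have hρa : ∀ t, t < a → deriv R t = 0 := fun t ht => by
    have : R =ᶠ[𝓝 t] fun _ => 0 := by
      filter_upwards [Iio_mem_nhds ht] with s hs using hR0 s (le_of_lt hs)
    rw [this.deriv_eq, deriv_const]
  have hρb : ∀ t, b < t → deriv R t = 0 := fun t ht => by
    have : R =ᶠ[𝓝 t] fun _ => R b := by
      filter_upwards [Ioi_mem_nhds ht] with s hs using hRb s (le_of_lt hs)
    rw [this.deriv_eq, deriv_const]
  have hρc : HasCompactSupport (deriv R) :=
    HasCompactSupport.intro (isCompact_Icc (a := a) (b := b)) fun t ht => by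
      rw [Set.mem_Icc, not_and_or, not_le, not_le] at ht
      exact ht.elim (hρa t) (hρb t)
  -- A cutoff in `x_N`, equal to `1` wherever `R'` is nonzero: it makes `θ` compactly supported in
  -- `ℝ^N` without changing the slices that count.
  let χ : ContDiffBump (0 : ℝ) := ⟨|b| + 1, |b| + 2, by positivity, by linarith⟩
  have hχ1 : ∀ t, deriv R t ≠ 0 → χ t = 1 := fun t ht => by
    have h1 : a ≤ t := not_lt.1 fun h => ht (hρa t h)
    have h2 : t ≤ b := not_lt.1 fun h => ht (hρb t h)
    refine χ.one_of_mem_closedBall ?_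
    rw [Metric.mem_closedBall, dist_zero_right, Real.norm_eq_abs, abs_of_pos (ha.trans_le h1)]
    exact h2.trans ((le_abs_self b).trans (by simp [χ]))
  let F : Space N → ℝ := fun x => θ x.1 * χ x.2
  have hF : ContDiff ℝ ∞ F := (hθ.comp contDiff_fst).mul (χ.contDiff.comp contDiff_snd)
  have hFc : HasCompactSupport F := hasCompactSupport_fst_mul_snd hθc χ.hasCompactSupport
  have hF1 : ContDiff ℝ ∞ (partialD none F) := contDiff_partialD hF (by simp) none
  have hF1c : HasCompactSupport (partialD none F) := hasCompactSupport_partialD hFc none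
  let f : Space N → ℝ := fun x => F x * w x + partialD none F x * u x
  have hmeas : ∀ t, MeasurableSet {x : Space N | t < x.2} := fun t =>
    (isOpen_lt continuous_const continuous_snd).measurableSet
  have hf : ∀ t, 0 < t → IntegrableOn f {x | t < x.2} := fun t ht =>
    (integrableOn_mul_lt_snd hw.locallyIntegrable_deriv hF.continuous hFc ht).add
      (integrableOn_mul_lt_snd hw.locallyIntegrable hF1.continuous hF1c ht)
  -- `f` is only known to be integrable away from the boundary; truncation at height `a` is harmless
  -- because `R'` vanishes below `a`.
  let fa : Space N → ℝ := {x | a < x.2}.indicator f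
  have hfa : Integrable fa := (hf a ha).integrable_indicator (hmeas a)
  -- Integrated over `x`, `H` gives minus the trace integral times `R'(t)`; integrated over `t <
  -- x_N`, it gives `fa x * R x.2`.
  let H : ℝ × Space N → ℝ := {z | z.1 < z.2.2}.indicator fun z => deriv R z.1 * fa z.2
  have hH : Integrable H (volume.prod volume) :=
    ((hρ.continuous.integrable_of_hasCompactSupport hρc).mul_prod hfa).indicator
      (isOpen_lt continuous_fst (continuous_snd.comp continuous_snd)).measurableSet
  have hT : ∀ t, (∫ x', θ x' * tr t x') * deriv R t = -∫ x, H (t, x) := fun t => by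
    by_cases ht : deriv R t = 0
    · simp [H, ht, Set.indicator_apply]
    · have hat : a ≤ t := not_lt.1 fun h => ht (hρa t h)
      have h1 := (htr t (ha.trans_le hat)).integral_eq hp hw (ha.trans_le hat) hF hFc
      simp only [F, hχ1 t ht, mul_one] at h1
      rw [h1, neg_mul, mul_comm, ← integral_const_mul, ← integral_indicator (hmeas t)]
      congr 1
      refine integral_congr_ae (Eventually.of_forall fun x => ?_)
      by_cases hx : t < x.2
      · simp [H, fa, f, F, Set.indicator_apply, hx, hat.trans_lt hx]
      · simp [H, hx]
  have hHx : ∀ x, ∫ t, H (t, x) = fa x * R x.2 := fun x => by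
    have h1 : (fun t => H (t, x)) = (Set.Iio x.2).indicator fun t => deriv R t * fa x := by
      funext t
      simp [H, Set.indicator_apply]
    rw [h1, integral_indicator measurableSet_Iio, ← integral_Iic_eq_integral_Iio,
      integral_mul_const, mul_comm, integral_Iic_of_hasDerivAt_of_tendsto' (f := R) (m := 0)
      (fun t _ => (hR.differentiable (by norm_num) t).hasDerivAt)
      (hρ.continuous.integrable_of_hasCompactSupport hρc).integrableOn, sub_zero]
    refine tendsto_const_nhds.congr' ?_
    filter_upwards [Iic_mem_atBot a] with t ht using (hR0 t ht).symm
  -- No measurability of `tr` in `t` is assumed; integrability of the product is inherited from `H`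
  -- through Fubini.
  simp only [hT]
  refine ⟨hH.integral_prod_left.neg, ?_⟩
  rw [integral_neg, integral_integral_swap (f := fun t x => H (t, x)) hH]
  simp only [hHx]
  -- Testing the weak derivative with `F R` gives `∫ (F w + ∂_N F u) R = -∫ u F R'`, which cancels
  -- the minus sign from the slices.
  have hFR : IsTestFunction fun x => F x * R x.2 := by
    refine ⟨hF.mul (hR.comp contDiff_snd), hFc.mul_right, fun x hx => ?_⟩
    have hsub : Function.support (fun x => F x * R x.2) ⊆ {x : Space N | a ≤ x.2} := fun y hy =>
      show a ≤ y.2 from le_of_not_ge fun h => hy (by simp [hR0 _ h])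
    exact ha.trans_le
      (closure_minimal hsub (isClosed_le continuous_const continuous_snd) hx)
  have hwp := hw.eq _ hFR
  rw [partialD_none_mul_snd (hF.differentiable (by norm_num))
    (hR.differentiable (by norm_num))] at hwp
  have hhalf : {x : Space N | a < x.2} ⊆ halfSpace N := fun x hx => ha.trans hx
  have hint : ∀ {l G : Space N → ℝ} {r : ℝ → ℝ}, LocallyIntegrableOn l (halfSpace N) →
      Continuous G → HasCompactSupport G → Continuous r → (∀ t < a, r t = 0) →
      IntegrableOn (fun x => G x * r x.2 * l x) (halfSpace N) := by
    intro l G r hl hG hGc hr hr0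
    have hK := isCompact_inter_le_snd hGc a
    refine integrableOn_mul_of_integrableOn_compact isOpen_halfSpace.measurableSet hK
      (hl.integrableOn_compact_subset (fun _ hx => ha.trans_le hx.2) hK)
      (hG.mul (hr.comp continuous_snd)) fun x _ hx => ?_
    by_cases h : a ≤ x.2
    · rw [image_eq_zero_of_notMem_tsupport fun h' => hx ⟨h', h⟩, zero_mul]
    · rw [hr0 _ (not_le.1 h), mul_zero]
  have i1 := hint hw.locallyIntegrable_deriv hF.continuous hFc hR.continuous
    fun t ht => hR0 t ht.le
  have i2 := hint hw.locallyIntegrable hF1.continuous hF1c hR.continuous fun t ht => hR0 t ht.le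
  have i3 := hint hw.locallyIntegrable hF.continuous hFc hρ.continuous hρa
  have e1 : ∫ x, fa x * R x.2 = (∫ x in halfSpace N, F x * R x.2 * w x) +
      ∫ x in halfSpace N, partialD none F x * R x.2 * u x := by
    rw [← integral_add i1 i2, ← integral_indicator isOpen_halfSpace.measurableSet]
    refine integral_congr_ae (Eventually.of_forall fun x => ?_)
    by_cases hx : a < x.2
    · simp only [fa, f, Set.indicator_of_mem (show x ∈ {x : Space N | a < x.2} from hx),
        Set.indicator_of_mem (hhalf hx)]
      ring
    · have hRx : R x.2 = 0 := hR0 _ (not_lt.1 hx)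
      simp only [hRx, mul_zero]
      exact (Set.indicator_apply_eq_zero.2 fun _ => by simp [hRx]).symm
  have e2 : ∫ x in halfSpace N, u x * (partialD none F x * R x.2 + F x * deriv R x.2) =
      (∫ x in halfSpace N, partialD none F x * R x.2 * u x) +
        ∫ x in halfSpace N, F x * deriv R x.2 * u x := by
    rw [← integral_add i2 i3]
    congr 1
    funext x
    ring
  have e3 : ∫ x in halfSpace N, u x * (θ x.1 * deriv R x.2) =
      ∫ x in halfSpace N, F x * deriv R x.2 * u x := by
    congr 1
    funext x
    by_cases h : deriv R x.2 = 0
    · simp [h]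
    · simp only [F, hχ1 _ h]
      ring
  have e4 : ∫ x in halfSpace N, w x * (F x * R x.2) = ∫ x in halfSpace N, F x * R x.2 * w x := by
    simp only [mul_comm (w _)]
  rw [e2, e4] at hwp
  rw [e1, e3]
  linarith

end Trace

/-! ### The weak equation for smooth test functions -/

section SmoothTest

variable {N : ℕ}

lemma deriv_comp_div {η : ℝ → ℝ} (hη : Differentiable ℝ η) (ε : ℝ) :
    deriv (fun t => η (t / ε)) = fun t => deriv η (t / ε) / ε := by
  funext t
  have := (hη (t / ε)).hasDerivAt.comp t ((hasDerivAt_id t).div_const ε)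
  rw [mul_one_div] at this
  exact this.deriv

/-- A smooth transition from `0` to `1`. -/
lemma exists_smooth_step : ∃ (η : ℝ → ℝ) (D : ℝ), ContDiff ℝ ∞ η ∧ 0 ≤ D ∧
    (∀ t, t ≤ 1 → η t = 0) ∧ (∀ t, 2 ≤ t → η t = 1) ∧ (∀ t, 0 ≤ η t) ∧ (∀ t, η t ≤ 1) ∧
    (∀ t, |deriv η t| ≤ D) ∧ (∀ t, |deriv (deriv η) t| ≤ D) := by
  have hη : ContDiff ℝ ∞ fun t : ℝ => Real.smoothTransition (t - 1) :=
    Real.smoothTransition.contDiff.comp (contDiff_id.sub contDiff_const)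
  have h1 := (contDiff_infty_iff_deriv.1 hη).2
  have h2 := (contDiff_infty_iff_deriv.1 h1).2
  have hc : HasCompactSupport (deriv fun t : ℝ => Real.smoothTransition (t - 1)) := by
    refine HasCompactSupport.intro (isCompact_Icc (a := (1 : ℝ)) (b := 2)) fun t ht => ?_
    rw [Set.mem_Icc, not_and_or, not_le, not_le] at ht
    rcases ht with ht | ht
    · have : (fun t : ℝ => Real.smoothTransition (t - 1)) =ᶠ[𝓝 t] fun _ => 0 := by
        filter_upwards [Iio_mem_nhds ht] with s hs
        exact Real.smoothTransition.zero_of_nonpos (by linarith [Set.mem_Iio.1 hs])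
      rw [this.deriv_eq, deriv_const]
    · have : (fun t : ℝ => Real.smoothTransition (t - 1)) =ᶠ[𝓝 t] fun _ => 1 := by
        filter_upwards [Ioi_mem_nhds ht] with s hs
        exact Real.smoothTransition.one_of_one_le (by linarith [Set.mem_Ioi.1 hs])
      rw [this.deriv_eq, deriv_const]
  obtain ⟨D1, hD1⟩ := hc.exists_bound_of_continuous h1.continuous
  obtain ⟨D2, hD2⟩ := hc.deriv.exists_bound_of_continuous h2.continuous
  exact ⟨_, max D1 D2, hη, ((norm_nonneg _).trans (hD1 0)).trans (le_max_left _ _),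
    fun t ht => Real.smoothTransition.zero_of_nonpos (by linarith),
    fun t ht => Real.smoothTransition.one_of_one_le (by linarith),
    fun t => Real.smoothTransition.nonneg _, fun t => Real.smoothTransition.le_one _,
    fun t => (hD1 t).trans (le_max_left _ _), fun t => (hD2 t).trans (le_max_right _ _)⟩

/-- A family of kernels of mass one concentrating at `0⁺` recovers the limit at `0⁺`. -/
lemma tendsto_integral_mul_of_concentrating {T : ℝ → ℝ} {L : ℝ}
    (hT : Tendsto T (𝓝[>] 0) (𝓝 L)) {k : ℕ → ℝ → ℝ} {ε : ℕ → ℝ} {C : ℝ} (hC : 0 ≤ C)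
    (hε : ∀ n, 0 < ε n) (hε0 : Tendsto ε atTop (𝓝 0))
    (hTk : ∀ n, Integrable fun t => T t * k n t) (hk : ∀ n, Integrable (k n))
    (hk1 : ∀ n, ∫ t, k n t = 1) (hle : ∀ n t, |k n t| ≤ C / ε n)
    (hsupp : ∀ n t, t ∉ Set.Ioc 0 (3 * ε n) → k n t = 0) :
    Tendsto (fun n => ∫ t, T t * k n t) atTop (𝓝 L) := by
  rw [Metric.tendsto_atTop']
  intro δ hδ
  -- The kernels may change sign, but their `L¹` norm is at most `3 * C`: height `C / ε n` on an
  -- interval of length `3 * ε n`. The `+ 1` gives a strict inequality and covers `C = 0`.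
  obtain ⟨r, hr, hTr⟩ := Metric.mem_nhdsWithin_iff.1
    (hT (Metric.closedBall_mem_nhds L (ε := δ / (3 * C + 1)) (by positivity)))
  obtain ⟨n0, hn0⟩ :=
    (hε0.eventually (gt_mem_nhds (show 0 < r / 3 by positivity))).exists_forall_of_atTop
  refine ⟨n0, fun n hn => ?_⟩
  have hεn := hn0 n hn.le
  have hpos := hε n
  have h1 : (∫ t, T t * k n t) - L = ∫ t in Set.Ioc 0 (3 * ε n), (T t - L) * k n t := by
    rw [setIntegral_eq_integral_of_forall_compl_eq_zero fun t ht => by rw [hsupp n t ht, mul_zero]]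
    simp only [sub_mul]
    rw [integral_sub (hTk n) ((hk n).const_mul L), integral_const_mul, hk1, mul_one]
  have h2 : ‖∫ t in Set.Ioc 0 (3 * ε n), (T t - L) * k n t‖ ≤
      (δ / (3 * C + 1) * (C / ε n)) * volume.real (Set.Ioc 0 (3 * ε n)) := by
    refine norm_setIntegral_le_of_norm_le_const measure_Ioc_lt_top fun t ht => ?_
    rw [norm_mul]
    refine mul_le_mul ?_ (hle n t) (norm_nonneg _) (by positivity)
    have : t ∈ Metric.ball 0 r ∩ Set.Ioi 0 := by
      refine ⟨?_, ht.1⟩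
      rw [Metric.mem_ball, dist_zero_right, Real.norm_eq_abs, abs_of_pos ht.1]
      linarith [ht.2]
    exact mem_closedBall_iff_norm.1 (hTr this)
  rw [Real.dist_eq, h1, ← Real.norm_eq_abs]
  refine h2.trans_lt ?_
  rw [Real.volume_real_Ioc_of_le (by positivity)]
  have h3 : δ / (3 * C + 1) * (C / ε n) * (3 * ε n - 0) = δ * (3 * C / (3 * C + 1)) := by
    field_simp
    ring
  rw [h3]
  have : 3 * C / (3 * C + 1) < 1 := by
    rw [div_lt_one (by positivity)]
    linarith
  nlinarith

lemma smooth_weak_equation {μ : LocalRadonMeasure (halfSpace N)} (hμ : IsWeighted μ)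
    {u : Space N → ℝ} (hu : IsL1LocClosure u) (hΔ : IsDistribSolution u μ)
    {ν : LocalRadonMeasure (Bdry N)} (hν : HasLimTrace u ν) {φ : Space N → ℝ}
    (hφ : ContDiff ℝ ∞ φ) (hc : HasCompactSupport φ) (h0 : ∀ x', φ (x', 0) = 0) :
    (∫ x in halfSpace N, u x * laplace φ x) + ν.integral (fun x' => partialD none φ (x', 0)) =
      μ.integral fun x => φ x := by
  obtain ⟨p, hp, -, ⟨-, hwp⟩, tr, htr, htrl⟩ := hν
  obtain ⟨w, hw, -⟩ := hwp none
  obtain ⟨η, D, hη, hD, hη0, hη1, hηn, hηle, hD1, hD2⟩ := exists_smooth_step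
  have e2 : (2 : WithTop ℕ∞) ≤ ∞ := WithTop.coe_le_coe.2 (le_top : (2 : ℕ∞) ≤ ⊤)
  have hφ1 : ContDiff ℝ ∞ (partialD none φ) := contDiff_partialD hφ (by simp) none
  have hφ1c : HasCompactSupport (partialD none φ) := hasCompactSupport_partialD hc none
  have hφ2 : ContDiff ℝ ∞ (partialD none (partialD none φ)) :=
    contDiff_partialD hφ1 (by simp) none
  have hφ2c := hasCompactSupport_partialD hφ1c none
  have hlap : Continuous (laplace φ) := continuous_laplace (hφ.of_le e2)
  have hlapc : HasCompactSupport (laplace φ) :=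
    HasCompactSupport.intro hc.isCompact fun x hx => laplace_eq_zero_of_notMem hx
  obtain ⟨C1, hC1n, hC1⟩ := exists_bound_of_hasCompactSupport hφ1.continuous hφ1c
  obtain ⟨C2, hC2n, hC2⟩ := exists_bound_of_hasCompactSupport hφ2.continuous hφ2c
  obtain ⟨CL, hCLn, hCL⟩ := exists_bound_of_hasCompactSupport hlap hlapc
  obtain ⟨r, hr⟩ := hc.isCompact.isBounded.subset_closedBall 0
  -- the normal derivative on the boundary
  let θ : Bdry N → ℝ := fun x' => partialD none φ (x', 0)
  have hθ : ContDiff ℝ ∞ θ := hφ1.comp (contDiff_id.prodMk contDiff_const)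
  have hθr : ∀ x', r < ‖x'‖ → θ x' = 0 := fun x' hx' => by
    refine partialD_eq_zero_of_notMem (fun h => ?_) none
    have := hr h
    rw [Metric.mem_closedBall, dist_zero_right] at this
    exact absurd ((norm_fst_le ((x', 0) : Space N)).trans this) (not_le.2 hx')
  have hθc : HasCompactSupport θ := HasCompactSupport.intro (isCompact_closedBall 0 r)
    fun x' hx' => hθr x' (by simpa using hx')
  let ε : ℕ → ℝ := fun n => 1 / ((n : ℝ) + 1)
  have hε : ∀ n, 0 < ε n := fun n => by positivity
  have hε1 : ∀ n, ε n ≤ 1 := fun n => by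
    simp only [ε]
    rw [div_le_one (by positivity)]
    linarith [(Nat.cast_nonneg n : (0 : ℝ) ≤ n)]
  have hε0 : Tendsto ε atTop (𝓝 0) := tendsto_one_div_add_atTop_nhds_zero_nat
  -- the cutoffs and their derivatives
  let E : ℕ → ℝ → ℝ := fun n t => η (t / ε n)
  have hE : ∀ n, ContDiff ℝ ∞ (E n) := fun n => hη.comp (contDiff_id.div_const _)
  have hE1 : ∀ n, ContDiff ℝ ∞ (deriv (E n)) := fun n => (contDiff_infty_iff_deriv.1 (hE n)).2
  have hE2 : ∀ n, ContDiff ℝ ∞ (deriv (deriv (E n))) := fun n =>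
    (contDiff_infty_iff_deriv.1 (hE1 n)).2
  have hη1d : ContDiff ℝ ∞ (deriv η) := (contDiff_infty_iff_deriv.1 hη).2
  have dE1 : ∀ n, deriv (E n) = fun t => deriv η (t / ε n) / ε n := fun n =>
    deriv_comp_div (hη.differentiable (by norm_num)) _
  have dE2 : ∀ n, deriv (deriv (E n)) = fun t => deriv (deriv η) (t / ε n) / ε n / ε n :=
    fun n => by
      rw [dE1]
      funext t
      rw [deriv_div_const, deriv_comp_div (hη1d.differentiable (by norm_num))]
  have bE1 : ∀ n t, |deriv (E n) t| ≤ D / ε n := fun n t => by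
    rw [dE1, abs_div, abs_of_pos (hε n)]
    exact div_le_div_of_nonneg_right (hD1 _) (hε n).le
  have bE2 : ∀ n t, |deriv (deriv (E n)) t| ≤ D / ε n / ε n := fun n t => by
    rw [dE2, abs_div, abs_div, abs_of_pos (hε n)]
    exact div_le_div_of_nonneg_right (div_le_div_of_nonneg_right (hD2 _) (hε n).le) (hε n).le
  have zE : ∀ n t, t ≤ ε n → E n t = 0 := fun n t ht => hη0 _ ((div_le_one (hε n)).2 ht)
  have oE : ∀ n t, 2 * ε n ≤ t → E n t = 1 := fun n t ht => hη1 _ ((le_div_iff₀ (hε n)).2 ht)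
  have zE1 : ∀ n t, t < ε n ∨ 2 * ε n < t → deriv (E n) =ᶠ[𝓝 t] fun _ => 0 := fun n t ht => by
    rcases ht with ht | ht
    · have : E n =ᶠ[𝓝 t] fun _ => 0 := by
        filter_upwards [Iio_mem_nhds ht] with s hs using zE n s (le_of_lt hs)
      simpa using this.deriv
    · have : E n =ᶠ[𝓝 t] fun _ => 1 := by
        filter_upwards [Ioi_mem_nhds ht] with s hs using oE n s (le_of_lt hs)
      simpa using this.deriv
  have zE2 : ∀ n t, t < ε n ∨ 2 * ε n < t → deriv (deriv (E n)) t = 0 := fun n t ht => by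
    rw [(zE1 n t ht).deriv_eq, deriv_const]
  -- the kernels
  let R : ℕ → ℝ → ℝ := fun n t => E n t + t * deriv (E n) t
  have hR : ∀ n, ContDiff ℝ ∞ (R n) := fun n => (hE n).add (contDiff_id.mul (hE1 n))
  -- Since `R = (tE)'`, its derivative is `2E' + tE''`, the factor multiplying `θ` after the Taylor
  -- replacement.
  have dR : ∀ n, deriv (R n) = fun t => 2 * deriv (E n) t + t * deriv (deriv (E n)) t :=
    fun n => by
      funext t
      have h1 := ((hE n).differentiable (by norm_num) t).hasDerivAt
      have h2 := ((hE1 n).differentiable (by norm_num) t).hasDerivAt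
      refine ((h1.add ((hasDerivAt_id t).mul h2)).deriv).trans ?_
      simp only [id]
      ring
  -- The thresholds `ε n / 2` and `3 * ε n` leave room around `[ε n, 2 * ε n]`, so that `E` is
  -- locally constant there and no endpoint needs treatment.
  have zR : ∀ n, ∀ t ≤ ε n / 2, R n t = 0 := fun n t ht => by
    have h1 : t < ε n := ht.trans_lt (half_lt_self (hε n))
    simp [R, zE n t h1.le, (zE1 n t (Or.inl h1)).eq_of_nhds]
  have oR : ∀ n, ∀ t, 3 * ε n ≤ t → R n t = 1 := fun n t ht => by
    have h1 : 2 * ε n < t := by linarith [hε n]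
    simp [R, oE n t h1.le, (zE1 n t (Or.inr h1)).eq_of_nhds]
  have hRk : ∀ n t, t ∉ Set.Ioc 0 (3 * ε n) → deriv (R n) t = 0 := fun n t ht => by
    have h1 : t < ε n ∨ 2 * ε n < t := by
      rw [Set.mem_Ioc, not_and_or, not_lt, not_le] at ht
      rcases ht with ht | ht
      · exact Or.inl (ht.trans_lt (hε n))
      · exact Or.inr (by linarith [hε n])
    rw [dR]
    simp [zE2 n t h1, (zE1 n t h1).eq_of_nhds]
  have hRc : ∀ n, Continuous (deriv (R n)) := fun n =>
    (contDiff_infty_iff_deriv.1 (hR n)).2.continuous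
  have hRi : ∀ n, Integrable (deriv (R n)) := fun n =>
    (hRc n).integrable_of_hasCompactSupport (HasCompactSupport.intro
      (isCompact_Icc (a := 0) (b := 3 * ε n)) fun t ht => hRk n t fun h =>
        ht (Set.Ioc_subset_Icc_self h))
  have hR1 : ∀ n, ∫ t, deriv (R n) t = 1 := fun n => by
    rw [integral_of_hasDerivAt_of_tendsto (f := R n) (m := 0) (n := 1)
      (fun t => ((hR n).differentiable (by norm_num) t).hasDerivAt) (hRi n), sub_zero]
    · refine tendsto_const_nhds.congr' ?_
      filter_upwards [Iic_mem_atBot (ε n / 2)] with t ht using (zR n t ht).symm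
    · refine tendsto_const_nhds.congr' ?_
      filter_upwards [Ici_mem_atTop (3 * ε n)] with t ht using (oR n t ht).symm
  -- The `5` is `2` from `2E'` plus `3` from `t ≤ 3 * ε n` in `tE''`.
  have bR : ∀ n t, |deriv (R n) t| ≤ 5 * D / ε n := fun n t => by
    by_cases ht : t ∈ Set.Ioc 0 (3 * ε n)
    · rw [dR]
      refine (abs_add_le _ _).trans ?_
      rw [abs_mul, abs_mul, abs_of_pos ht.1, abs_two]
      have h1 : t * |deriv (deriv (E n)) t| ≤ 3 * ε n * (D / ε n / ε n) :=
        mul_le_mul ht.2 (bE2 n t) (abs_nonneg _) (by have := hε n; positivity)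
      have h2 : 3 * ε n * (D / ε n / ε n) = 3 * (D / ε n) := by
        have := (hε n).ne'
        field_simp
      have h3 : 5 * D / ε n = 2 * (D / ε n) + 3 * (D / ε n) := by ring
      rw [h3]
      linarith [bE1 n t]
    · rw [hRk n t ht, abs_zero]
      have := hε n
      positivity
  have htrace := fun n => integral_trace_mul_deriv hp.le hw htr hθ hθc (half_pos (hε n)) (hR n)
    (zR n) (b := 3 * ε n) fun t ht => (oR n t ht).trans (oR n _ le_rfl).symm
  have hlimT : Tendsto (fun n => ∫ x in halfSpace N, u x * (θ x.1 * deriv (R n) x.2)) atTop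
      (𝓝 (ν.integral θ)) := by
    simp only [← (htrace _).2]
    exact tendsto_integral_mul_of_concentrating (htrl θ (hθ.of_le e2) hθc)
      (C := 5 * D) (by positivity) hε hε0 (fun n => (htrace n).1) hRi hR1 bR hRk
  -- the remainder
  let g : ℕ → Space N → ℝ := fun n x => laplace φ x * E n x.2 +
    2 * (partialD none φ x - θ x.1) * deriv (E n) x.2 +
      (φ x - x.2 * θ x.1) * deriv (deriv (E n)) x.2
  have hθ' : Continuous fun x : Space N => θ x.1 := hθ.continuous.comp continuous_fst
  have hg : ∀ n, Continuous (g n) := fun n => by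
    have h1 := (hE n).continuous.comp (continuous_snd (X := Bdry N))
    have h2 := (hE1 n).continuous.comp (continuous_snd (X := Bdry N))
    have h3 := (hE2 n).continuous.comp (continuous_snd (X := Bdry N))
    exact ((hlap.mul h1).add ((continuous_const.mul (hφ1.continuous.sub hθ')).mul h2)).add
      ((hφ.continuous.sub (continuous_snd.mul hθ')).mul h3)
  have hEn : ∀ n t, |E n t| ≤ 1 := fun n t => abs_le.2 ⟨by linarith [hηn (t / ε n)], hηle _⟩
  -- A bound independent of `n`: where `x_N ≤ 2 * ε n`, the Taylor errors `C2 x_N` and `C2 x_N²`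
  -- absorb the factors `1/ε` and `1/ε²` of `E'` and `E''`.
  have bg : ∀ n x, 0 < x.2 → |g n x| ≤ CL + (2 * (C2 * (2 * D)) + C2 * (4 * D)) := fun n x hx => by
    have hεn := hε n
    have b1 : |laplace φ x * E n x.2| ≤ CL := by
      rw [abs_mul]
      exact (mul_le_mul (hCL x) (hEn n _) (abs_nonneg _) hCLn).trans (mul_one _).le
    by_cases ht : 2 * ε n < x.2
    · simp only [g, (zE1 n _ (Or.inr ht)).eq_of_nhds, zE2 n _ (Or.inr ht), mul_zero, add_zero]
      have : 0 ≤ 2 * (C2 * (2 * D)) + C2 * (4 * D) := by positivity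
      linarith
    · have ht' := not_lt.1 ht
      have b2 : |2 * (partialD none φ x - θ x.1) * deriv (E n) x.2| ≤ 2 * (C2 * (2 * D)) := by
        rw [abs_mul, abs_mul, abs_two, mul_assoc]
        refine mul_le_mul_of_nonneg_left ?_ zero_le_two
        refine (mul_le_mul (abs_sub_boundary_le (hφ1.differentiable (by norm_num)) hx.le
          fun t _ => hC2 _) (bE1 n _) (abs_nonneg _) (by positivity)).trans ?_
        rw [mul_assoc]
        refine mul_le_mul_of_nonneg_left ?_ hC2n
        rw [mul_div_assoc', div_le_iff₀ hεn]
        nlinarith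
      have b3 : |(φ x - x.2 * θ x.1) * deriv (deriv (E n)) x.2| ≤ C2 * (4 * D) := by
        rw [abs_mul]
        refine (mul_le_mul (abs_sub_taylor_le (hφ.of_le e2) hC2 x.1 hx.le (h0 _))
          (bE2 n _) (abs_nonneg _) (by positivity)).trans ?_
        rw [mul_assoc, mul_assoc]
        refine mul_le_mul_of_nonneg_left ?_ hC2n
        rw [← mul_assoc, mul_div_assoc', div_le_iff₀ hεn, mul_div_assoc', div_le_iff₀ hεn]
        have : x.2 * x.2 ≤ (2 * ε n) * (2 * ε n) := mul_self_le_mul_self hx.le ht'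
        nlinarith
      exact (abs_add_le _ _).trans ((add_le_add ((abs_add_le _ _).trans (add_le_add b1 b2))
        b3).trans (by linarith))
  -- Terms containing `θ x.1` need not vanish off the support of `φ`; the ball must also contain the
  -- strip `0 < x_N ≤ 3 * ε n ≤ 3` above the support of `θ`.
  have hθout : ∀ n (x : Space N), 0 < x.2 → x ∉ Metric.closedBall 0 (max r 0 + 3) →
      r < ‖x.1‖ ∨ 3 * ε n < x.2 := fun n x hx h => by
    rw [Metric.mem_closedBall, dist_zero_right, not_le, Prod.norm_def, lt_max_iff,
      Real.norm_eq_abs, abs_of_pos hx] at h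
    have h1 := le_max_left r 0
    have h2 := le_max_right r 0
    rcases h with h | h
    · exact Or.inl (by linarith)
    · exact Or.inr (by linarith [hε1 n])
  have hout' : ∀ x : Space N, x ∉ Metric.closedBall 0 (max r 0 + 3) → x ∉ tsupport φ :=
    fun x hx h => hx (Metric.closedBall_subset_closedBall (by linarith [le_max_left r 0]) (hr h))
  have sg : ∀ n x, 0 < x.2 → x ∉ Metric.closedBall 0 (max r 0 + 3) → g n x = 0 :=
    fun n x hx hxr => by
      have hs := hout' x hxr
      simp only [g, laplace_eq_zero_of_notMem hs, partialD_eq_zero_of_notMem hs,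
        image_eq_zero_of_notMem_tsupport hs]
      rcases hθout n x hx hxr with h | h
      · simp [hθr _ h]
      · have h' : 2 * ε n < x.2 := by linarith [hε n]
        simp [(zE1 n _ (Or.inr h')).eq_of_nhds, zE2 n _ (Or.inr h')]
  have hlarge : ∀ x : Space N, 0 < x.2 → ∀ᶠ n in atTop, 2 * ε n < x.2 := fun x hx => by
    filter_upwards [hε0.eventually (gt_mem_nhds (show 0 < x.2 / 2 by positivity))] with n hn
    linarith
  -- At a fixed `x` the terms in `E'` and `E''` vanish as soon as `2 * ε n < x_N`, so the remainder
  -- leaves no boundary contribution.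
  have hlimg : Tendsto (fun n => ∫ x in halfSpace N, u x * g n x) atTop
      (𝓝 (∫ x in halfSpace N, u x * laplace φ x)) := by
    refine hu.integral_tendsto hg bg sg fun x hx => tendsto_const_nhds.congr' ?_
    filter_upwards [hlarge x hx] with n hn
    simp [g, oE n _ hn.le, (zE1 n _ (Or.inr hn)).eq_of_nhds, zE2 n _ (Or.inr hn)]
  have hlimμ : Tendsto (fun n => μ.integral fun x => φ x * E n (x : Space N).2) atTop
      (𝓝 (μ.integral fun x => φ x)) := by
    refine hμ.integral_tendsto (f := fun n x => φ x * E n x.2) (C := C1) (R := r)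
      (fun n => hφ.continuous.mul ((hE n).continuous.comp continuous_snd)) (fun n x hx => ?_)
      (fun n x hx => ?_) fun x hx => tendsto_const_nhds.congr' ?_
    · have := abs_sub_boundary_le (hφ.differentiable (by norm_num)) (x' := x.1) hx.le
        fun t _ => hC1 _
      rw [h0, sub_zero] at this
      rw [abs_mul]
      exact (mul_le_mul this (hEn n _) (abs_nonneg _) (by positivity)).trans (mul_one _).le
    · rw [image_eq_zero_of_notMem_tsupport fun h => hx (hr h), zero_mul]
    · filter_upwards [hlarge x hx] with n hn
      rw [oE n _ hn.le, mul_one]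
  -- the equation for the cut off test function
  have htest : ∀ n, IsTestFunction fun x => φ x * E n x.2 := fun n => by
    refine ⟨hφ.mul ((hE n).comp contDiff_snd), hc.mul_right, fun x hx => ?_⟩
    have hsub : Function.support (fun x => φ x * E n x.2) ⊆ {x : Space N | ε n ≤ x.2} :=
      fun y hy => show ε n ≤ y.2 from le_of_not_ge fun h => hy (by simp [zE n _ h])
    exact (hε n).trans_le
      (closure_minimal hsub (isClosed_le continuous_const continuous_snd) hx)
  have heq : ∀ n, (∫ x in halfSpace N, u x * g n x) +
      ∫ x in halfSpace N, u x * (θ x.1 * deriv (R n) x.2) =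
        μ.integral fun x => φ x * E n (x : Space N).2 := fun n => by
    rw [← hΔ _ (htest n), ← integral_add (hu.integrable_mul (hg n) (bg n) (sg n))
      (hu.integrable_mul (f := fun x => θ x.1 * deriv (R n) x.2)
        (C := C1 * (5 * D / ε n)) (R := max r 0 + 3)
        (hθ'.mul ((hRc n).comp continuous_snd)) (fun x _ => ?_) fun x hx hxr => ?_)]
    · congr 1
      funext x
      rw [laplace_mul_snd (hφ.of_le e2) ((hE n).of_le e2), dR]
      simp only [g]
      ring
    · rw [abs_mul]
      exact mul_le_mul (hC1 _) (bR n _) (abs_nonneg _) hC1n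
    · rcases hθout n x hx hxr with h | h
      · rw [hθr _ h, zero_mul]
      · rw [hRk n _ fun h' => absurd h'.2 (not_le.2 h), mul_zero]
  have hsum := hlimg.add hlimT
  simp only [heq] at hsum
  exact tendsto_nhds_unique hsum hlimμ

end SmoothTest

/-! ### Passage from smooth to `C²` test functions -/

theorem mainTheorem8 (N : ℕ) (hN : 2 ≤ N)
    (μ : LocalRadonMeasure (halfSpace N)) (hμ : IsWeighted μ)
    (u : Space N → ℝ) (hu : IsL1LocClosure u) (hΔ : IsDistribSolution u μ)
    (ν : LocalRadonMeasure (Bdry N)) (hν : HasLimTrace u ν) :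
    IsWeakSolution u μ ν := by
  refine ⟨hμ, hu, fun φ hφ => ?_⟩
  obtain ⟨ψ, C, R, hψ, hψ0, hψs, hψ1, hψ2, hlim, hlim1, hlim2⟩ := exists_smooth_approx hφ
  have e2 : (2 : WithTop ℕ∞) ≤ ∞ := WithTop.coe_le_coe.2 (le_top : (2 : ℕ∞) ≤ ⊤)
  have hts : ∀ n, ∀ x ∉ Metric.closedBall 0 R, x ∉ tsupport (ψ n) := fun n x hx h =>
    hx (closure_minimal (Function.support_subset_iff'.2 (hψs n)) Metric.isClosed_closedBall h)
  have hc : ∀ n, HasCompactSupport (ψ n) := fun n =>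
    HasCompactSupport.intro (isCompact_closedBall 0 R) (hψs n)
  have heq := fun n => smooth_weak_equation hμ hu hΔ hν (hψ n) (hc n) (hψ0 n)
  have h1 : Tendsto (fun n => ∫ x in halfSpace N, u x * laplace (ψ n) x) atTop
      (𝓝 (∫ x in halfSpace N, u x * laplace φ x)) :=
    hu.integral_tendsto (fun n => continuous_laplace ((hψ n).of_le e2)) (fun n x _ => hψ2 n x)
      (fun n x _ hx => laplace_eq_zero_of_notMem (hts n x hx)) fun x _ => hlim2 x
  have h2 : Tendsto (fun n => ν.integral fun x' => partialD none (ψ n) (x', 0)) atTop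
      (𝓝 (ν.integral fun x' => partialD none φ (x', 0))) := by
    refine boundary_integral_tendsto ν (R := R) (fun n =>
      (contDiff_partialD (m := ∞) (hψ n) (by simp) none).continuous.comp (by fun_prop))
      (fun n x' => hψ1 n (x', 0)) (fun n x' hx' => partialD_eq_zero_of_notMem (hts n _ ?_) none)
      fun x' => hlim1 (x', 0)
    rw [Metric.mem_closedBall, dist_zero_right, not_le] at hx' ⊢
    exact hx'.trans_le (norm_fst_le ((x', 0) : Space N))
  -- The uniform bound on `∂_N (ψ n)` and the zero boundary values give the common majorant `C x_N`.
  have h3 : Tendsto (fun n => μ.integral fun x => ψ n x) atTop (𝓝 (μ.integral fun x => φ x)) := by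
    refine hμ.integral_tendsto (C := C) (fun n => (hψ n).continuous) (fun n x hx => ?_) hψs
      fun x _ => hlim x
    have := abs_sub_boundary_le ((hψ n).differentiable (by norm_num)) (x' := x.1) hx.le
      fun t _ => hψ1 n _
    rwa [hψ0, sub_zero] at this
  have hsum := h1.add h2
  simp only [heq] at hsum
  have hfin := tendsto_nhds_unique h3 hsum
  simp only [mul_neg, integral_neg]
  linarith
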